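/- Let $G$ be a compact metric graph: $G$ is obtained from a finite connected graph with vertex set $V\ne\varnothing$ and edge set $E$ (loops and multiple edges allowed) and edge lengths $\ell(e)\in(0,\infty)$ by gluing the intervals $[0,\ell(e)]$, $e\in E$, at the vertices. Let $H^1(G)$ be the space of continuous $f\colon G\to\mathbb R$ whose restriction to every edge $e$ lies in the Sobolev space $H^1((0,\ell(e)))$, and let $q(f,g)=\int_G f'g'\,dx$ for $f,g\in H^1(G)$. For a finite Borel measure $\mu$ on $G$ let $H^1(G,\mu)$ be the space of $f\in H^1(G)$ that are harmonic on $G\setminus\operatorname{supp}\mu$, that is, $q(f,g)=0$ for every $g\in H^1(G)$ that vanishes on $\operatorname{supp}\mu$. The Laplacian $H_\mu$ is the operator in $L^2(G,\mu)$ given by: $f\in\operatorname{dom}(H_\mu)$ and $H_\mu f=g\in L^2(G,\mu)$ if and only if $f\in H^1(G,\mu)$ and $q(f,\varphi)=\int_G g\varphi\,d\mu$ for all $\varphi\in H^1(G,\mu)$. Eigenfunctions of $H_\mu$ are understood through their continuous representatives in $H^1(G,\mu)$. Let $\lambda_0(H_\mu)\le\lambda_1(H_\mu)\le\cdots$ be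 the eigenvalues of $H_\mu$, counted with multiplicity, with $\lambda_k(H_\mu):=\infty$ if $k\ge\dim L^2(G,\mu)$. **Theorem (Spectral continuity).** Let $(\mu_m)_{m\in\mathbb N}$ be a sequence of finite Borel measures on $G$ that converges to a finite Borel measure $\mu$ in the weak-$*$ topology, that is, $\int_G f\,d\mu_m\to\int_G f\,d\mu$ for every continuous $f\colon G\to\mathbb R$. Let $k\in\mathbb N_0$. (i) If $\mu\neq 0$ or $k\ge 1$, then $\lim_{m\to\infty}\lambda_k(H_{\mu_m})=\lambda_k(H_\mu)$ in $[0,\infty]$. (ii) Suppose that $\lambda_k(H_\mu)<\infty$. Then $\lambda_k(H_{\mu_m})<\infty$ for all large $m$. Moreover, if for all large $m$ the functions $v_m^0,\dots,v_m^k$ are $L^2(G,\mu_m)$-orthonormal eigenfunctions of $H_{\mu_m}$ for the eigenvalues $\lambda_0(H_{\mu_m}),\dots,\lambda_k(H_{\mu_m})$, then, along a subsequence, $v_m^0,\dots,v_m^k$ converge uniformly on $G$ to $L^2(G,\mu)$-orthonormal eigenfunctions $v^0,\dots,v^k$ of $H_\mu$ for the eigenvalues $\lambda_0(H_\mu),\dots,\lambda_k(H_\mu)$.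 Consequently, for every $k\in\mathbb N_0$ the minimum $$\lambda_k^{\min}(G):=\min_{\nu}\lambda_k(H_\nu)$$ over all Borel probability measures $\nu$ on $G$ exists (in $[0,\infty]$). -/

import Mathlib

open MeasureTheory Set Filter Topology
open scoped ENNReal NNReal ContDiff

/-- A finite connected weighted multigraph (loops and multiple edges allowed), with vertex set `V`
and edge set `E`: every edge has an orientation `src e → tgt e` and a length `len e ∈ (0, ∞)`.
Finiteness of `V` and `E` is imposed by instance arguments. -/
structure MetricGraph (V E : Type*) where
  src : E → V
  tgt : E → V
  len : E → ℝ
  len_pos : ∀ e, 0 < len e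
  nonempty : Nonempty V
  connected : ∀ u v : V, Relation.EqvGen (fun a b => ∃ e, src e = a ∧ tgt e = b) u v

/-- The function `g` is a weak (distributional) derivative of `u` on the interval `(0, ℓ)`. -/
def IsWeakDeriv (ℓ : ℝ) (u g : ℝ → ℝ) : Prop :=
  ∀ φ : ℝ → ℝ, ContDiff ℝ ∞ φ → HasCompactSupport φ → tsupport φ ⊆ Ioo 0 ℓ →
    ∫ x in Ioo 0 ℓ, u x * deriv φ x = - ∫ x in Ioo 0 ℓ, g x * φ x

/-- The function `g` is a weak derivative of `u` on `(0, ℓ)` and belongs to `L²(0, ℓ)`. -/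
def IsL2WeakDeriv (ℓ : ℝ) (u g : ℝ → ℝ) : Prop :=
  MemLp g 2 (volume.restrict (Ioo 0 ℓ)) ∧ IsWeakDeriv ℓ u g

/-- The Sobolev space `H¹((0, ℓ))`. -/
def MemSobolev (ℓ : ℝ) (u : ℝ → ℝ) : Prop :=
  MemLp u 2 (volume.restrict (Ioo 0 ℓ)) ∧ ∃ g, IsL2WeakDeriv ℓ u g

open Classical in
/-- The weak derivative of a function in `H¹((0, ℓ))` (unique up to null sets). -/
noncomputable def weakDeriv (ℓ : ℝ) (u : ℝ → ℝ) : ℝ → ℝ :=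
  if h : ∃ g, IsL2WeakDeriv ℓ u g then h.choose else 0

namespace MetricGraph

variable {V E : Type*} (G : MetricGraph V E)

/-- The disjoint union of the vertices and of the intervals `[0, len e]`. -/
def Pre : Type _ := V ⊕ (Σ e : E, Icc (0 : ℝ) (G.len e))

/-- The vertices carry the discrete topology. -/
instance : TopologicalSpace G.Pre :=
  letI : TopologicalSpace V := ⊥
  inferInstanceAs (TopologicalSpace (V ⊕ (Σ e : E, Icc (0 : ℝ) (G.len e))))

/-- The left endpoint of every edge is glued to its initial vertex, the right endpoint to its
terminal vertex. -/
inductive Glue : G.Pre → G.Pre → Prop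
  | src (e : E) : Glue (Sum.inr ⟨e, 0, le_rfl, (G.len_pos e).le⟩) (Sum.inl (G.src e))
  | tgt (e : E) : Glue (Sum.inr ⟨e, G.len e, (G.len_pos e).le, le_rfl⟩) (Sum.inl (G.tgt e))

/-- The metric realization, as a topological space: the quotient of the disjoint union of the
vertices and edges by the equivalence relation generated by the gluing. -/
def Space : Type _ := Quot G.Glue

instance : TopologicalSpace G.Space := inferInstanceAs (TopologicalSpace (Quot G.Glue))

instance : MeasurableSpace G.Space := borel G.Space

instance : BorelSpace G.Space := ⟨rfl⟩

/-- The point with coordinate `t ∈ [0, len e]` on the edge `e` (other `t` are clamped). -/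
noncomputable def edgePoint (e : E) (t : ℝ) : G.Space :=
  Quot.mk _ (Sum.inr ⟨e, projIcc 0 (G.len e) (G.len_pos e).le t⟩)

/-- The restriction `f_e` of a function on the metric graph to the edge `e ≃ [0, len e]`. -/
noncomputable def onEdge (f : G.Space → ℝ) (e : E) : ℝ → ℝ := fun t => f (G.edgePoint e t)

/-- The Sobolev space `H¹(G)`: continuous functions whose restriction to each edge is `H¹`. -/
def H1 : Set (G.Space → ℝ) :=
  {f | Continuous f ∧ ∀ e, MemSobolev (G.len e) (G.onEdge f e)}

/-- The energy form `q(f, g) = ∫_G f' g' dx`. -/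
noncomputable def energy [Fintype E] (f g : G.Space → ℝ) : ℝ :=
  ∑ e, ∫ x in Ioo 0 (G.len e),
    weakDeriv (G.len e) (G.onEdge f e) x * weakDeriv (G.len e) (G.onEdge g e) x

/-- The function `f` (in `H¹(G)`) is harmonic on `O`. -/
def IsHarmonicOn [Fintype E] (f : G.Space → ℝ) (O : Set G.Space) : Prop :=
  ∀ g ∈ G.H1, (∀ x ∉ O, g x = 0) → G.energy f g = 0

/-- The space `H¹(G, μ)` of `H¹`-functions that are harmonic off the support of `μ`. -/
def H1Measure [Fintype E] (μ : Measure G.Space) : Set (G.Space → ℝ) :=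
  {f | f ∈ G.H1 ∧ G.IsHarmonicOn f μ.supportᶜ}

/-- The Laplacian `H_μ` in `L²(G, μ)`, given by its graph: `f ∈ dom H_μ` and `H_μ f = g`. Elements
of the domain are represented by their (continuous) representatives in `H¹(G, μ)`. -/
def IsLaplacian [Fintype E] (μ : Measure G.Space) (f g : G.Space → ℝ) : Prop :=
  f ∈ G.H1Measure μ ∧ MemLp g 2 μ ∧
    ∀ φ ∈ G.H1Measure μ, G.energy f φ = ∫ x, g x * φ x ∂μ

/-- The function `f` is an eigenfunction of `H_μ` for the eigenvalue `a`: it is nonzero in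
`L²(G, μ)` and `H_μ f = a f`. -/
def IsEigenfunction [Fintype E] (μ : Measure G.Space) (a : ℝ) (f : G.Space → ℝ) : Prop :=
  ¬ f =ᵐ[μ] 0 ∧ G.IsLaplacian μ f (fun x => a * f x)

/-- The subspace of `L²(G, μ)` spanned by the eigenfunctions of `H_μ` for eigenvalues `≤ Λ`. Its
dimension is the number of eigenvalues `≤ Λ`, counted with multiplicity. -/
noncomputable def spectralSubspace [Fintype E] (μ : Measure G.Space) (Λ : ℝ) :
    Submodule ℝ (Lp ℝ 2 μ) :=
  Submodule.span ℝ {u | ∃ a ≤ Λ, ∃ f, G.IsEigenfunction μ a f ∧ u =ᵐ[μ] f}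

/-- The `k`-th eigenvalue `λ_k(H_μ) ∈ [0, ∞]`, for `k = 0, 1, 2, …`, counting multiplicities: the
least `Λ` such that `H_μ` has at least `k + 1` eigenvalues `≤ Λ`. It is `∞` if `H_μ` has at most `k`
eigenvalues, that is, if `k ≥ dim L²(G, μ)`. -/
noncomputable def eigenvalue [Fintype E] (μ : Measure G.Space) (k : ℕ) : ℝ≥0∞ :=
  sInf {L | ∃ Λ : ℝ≥0, L = Λ ∧
    ((k + 1 : ℕ) : Cardinal) ≤ Module.rank ℝ (G.spectralSubspace μ Λ)}

/-- The `k`-th optimal eigenvalue: the infimum of `λ_k(H_ν)` over all Borel probability measures. -/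
noncomputable def minEigenvalue [Fintype E] (k : ℕ) : ℝ≥0∞ :=
  ⨅ ν : ProbabilityMeasure G.Space, G.eigenvalue (ν : Measure G.Space) k

/-- The functions `v 0, …, v k` are `L²(G, μ)`-orthonormal eigenfunctions of `H_μ` for the (finite)
eigenvalues `λ_0(H_μ), …, λ_k(H_μ)`. -/
def IsOrthonormalEigenfamily [Fintype E] (μ : Measure G.Space) (k : ℕ)
    (v : Fin (k + 1) → G.Space → ℝ) : Prop :=
  (∀ j : Fin (k + 1), G.eigenvalue μ j < ⊤ ∧
    G.IsEigenfunction μ (G.eigenvalue μ j).toReal (v j)) ∧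
  ∀ i j : Fin (k + 1), ∫ x, v i x * v j x ∂μ = if i = j then 1 else 0

end MetricGraph

/-! ### Weak derivatives on an interval -/

section Sobolev

/-! The energy does not depend on the measure. Only the mass form `∫ f g dμ` does, and it passes to
the limit when the measures converge weak-* and the functions converge uniformly
(`tendsto_massForm_of_tendsto`). In dimension one the energy controls oscillation: functions are
1/2-Hölder along edges, so sets bounded in energy and in sup norm are relatively compact in `C(G)`.
These facts, with the closedness of the form, are all that the spectral argument uses; `EnergySpace`
collects them.

Harmonic extension off the support shows that the eigenvalue equation may be tested against all of
`H¹(G)` (`isEigenfunction_iff`). Counting eigenvalues `≤ Λ` thus means finding mass-orthonormal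
solutions of one equation on a fixed space (`hasEigenfamily_iff`).

Upper semicontinuity of `λ_k`: the span of eigenfunctions for `μ` is a trial space for `μ_m`, with
almost the same Rayleigh quotients (`HasEigenfamily.eventually`). Lower semicontinuity and
convergence of eigenfunctions: when `μ ≠ 0`, orthonormal eigenfunctions with bounded eigenvalues are
bounded in energy and in sup norm, hence subconverge uniformly, and the limits are orthonormal
eigenfunctions for `μ` (`exists_subseq_tendsto_eigenfamily`). When `μ = 0` and `k ≥ 1`, a Poincaré
inequality forces `λ_k → ∞` as the mass tends to zero (`HasEigenfamily.one_le`). Minimisers exist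
because the probability measures on `G` are weak-* compact. -/

theorem memLp_test {φ : ℝ → ℝ} (hφ : ContDiff ℝ ∞ φ) (hs : HasCompactSupport φ)
    (s : Set ℝ) : MemLp φ 2 (volume.restrict s) :=
  (hφ.continuous.memLp_of_hasCompactSupport hs).restrict s

theorem memLp_deriv_test {φ : ℝ → ℝ} (hφ : ContDiff ℝ ∞ φ) (hs : HasCompactSupport φ)
    (s : Set ℝ) : MemLp (deriv φ) 2 (volume.restrict s) :=
  ((hφ.continuous_deriv (by simp)).memLp_of_hasCompactSupport hs.deriv).restrict s

theorem IsWeakDeriv.congr_ae {ℓ : ℝ} {u u' g g' : ℝ → ℝ} (h : IsWeakDeriv ℓ u g)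
    (hu : u =ᵐ[volume.restrict (Ioo 0 ℓ)] u') (hg : g =ᵐ[volume.restrict (Ioo 0 ℓ)] g') :
    IsWeakDeriv ℓ u' g' := by
  intro φ h1 h2 h3
  have e1 : ∫ x in Ioo 0 ℓ, u' x * deriv φ x = ∫ x in Ioo 0 ℓ, u x * deriv φ x :=
    integral_congr_ae (by filter_upwards [hu] with x hx; rw [hx])
  have e2 : ∫ x in Ioo 0 ℓ, g' x * φ x = ∫ x in Ioo 0 ℓ, g x * φ x :=
    integral_congr_ae (by filter_upwards [hg] with x hx; rw [hx])
  rw [e1, e2, h φ h1 h2 h3]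

theorem IsL2WeakDeriv.memLp {ℓ : ℝ} {u g : ℝ → ℝ} (h : IsL2WeakDeriv ℓ u g) :
    MemLp g 2 (volume.restrict (Ioo 0 ℓ)) :=
  h.1

/-- Fundamental lemma of the calculus of variations. It makes the arbitrary choice in `weakDeriv`
harmless, in particular linear modulo null sets. -/
theorem IsL2WeakDeriv.ae_eq {ℓ : ℝ} {u g g' : ℝ → ℝ} (h : IsL2WeakDeriv ℓ u g)
    (h' : IsL2WeakDeriv ℓ u g') : g =ᵐ[volume.restrict (Ioo 0 ℓ)] g' := by
  have hL : MemLp (fun x => g x - g' x) 2 (volume.restrict (Ioo 0 ℓ)) := h.1.sub h'.1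
  have := isOpen_Ioo.ae_eq_zero_of_integral_contDiff_smul_eq_zero (μ := volume)
    (U := Ioo 0 ℓ) (f := fun x => g x - g' x)
    (IntegrableOn.locallyIntegrableOn (hL.integrable (by norm_num))) ?_
  · rw [EventuallyEq, ae_restrict_iff' measurableSet_Ioo]
    filter_upwards [this] with x hx hm
    exact sub_eq_zero.1 (hx hm)
  · intro φ h1 h2 h3
    have hφ := memLp_test h1 h2 (Ioo 0 ℓ)
    have e0 : ∫ x, φ x • (g x - g' x) = ∫ x in Ioo 0 ℓ, φ x • (g x - g' x) := by
      rw [setIntegral_eq_integral_of_forall_compl_eq_zero]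
      intro x hx
      rw [image_eq_zero_of_notMem_tsupport fun hh => hx (h3 hh), zero_smul]
    have e1 : ∀ x, φ x • (g x - g' x) = g x * φ x - g' x * φ x := fun x => by
      rw [smul_eq_mul]; ring
    have i1 : Integrable (fun x => g x * φ x) (volume.restrict (Ioo 0 ℓ)) := h.1.integrable_mul hφ
    have i2 : Integrable (fun x => g' x * φ x) (volume.restrict (Ioo 0 ℓ)) :=
      h'.1.integrable_mul hφ
    rw [e0]
    simp only [e1]
    rw [integral_sub i1 i2]
    linarith [h.2 φ h1 h2 h3, h'.2 φ h1 h2 h3]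

theorem IsL2WeakDeriv.add {ℓ : ℝ} {u g u' g' : ℝ → ℝ} (h : IsL2WeakDeriv ℓ u g)
    (h' : IsL2WeakDeriv ℓ u' g') (hu : MemLp u 2 (volume.restrict (Ioo 0 ℓ)))
    (hu' : MemLp u' 2 (volume.restrict (Ioo 0 ℓ))) :
    IsL2WeakDeriv ℓ (u + u') (g + g') := by
  refine ⟨h.1.add h'.1, fun φ h1 h2 h3 => ?_⟩
  have hφ := memLp_test h1 h2 (Ioo 0 ℓ)
  have hφ' := memLp_deriv_test h1 h2 (Ioo 0 ℓ)
  have i1 : Integrable (fun x => g x * φ x) (volume.restrict (Ioo 0 ℓ)) := h.1.integrable_mul hφ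
  have i2 : Integrable (fun x => g' x * φ x) (volume.restrict (Ioo 0 ℓ)) := h'.1.integrable_mul hφ
  have i3 : Integrable (fun x => u x * deriv φ x) (volume.restrict (Ioo 0 ℓ)) :=
    hu.integrable_mul hφ'
  have i4 : Integrable (fun x => u' x * deriv φ x) (volume.restrict (Ioo 0 ℓ)) :=
    hu'.integrable_mul hφ'
  simp only [Pi.add_apply, add_mul]
  rw [integral_add i3 i4, integral_add i1 i2, h.2 φ h1 h2 h3,
    h'.2 φ h1 h2 h3]
  ring

theorem IsL2WeakDeriv.const_smul {ℓ : ℝ} {u g : ℝ → ℝ} (h : IsL2WeakDeriv ℓ u g) (c : ℝ) :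
    IsL2WeakDeriv ℓ (c • u) (c • g) := by
  refine ⟨h.1.const_smul c, fun φ h1 h2 h3 => ?_⟩
  simp only [Pi.smul_apply, smul_eq_mul, mul_assoc]
  rw [integral_const_mul, integral_const_mul, h.2 φ h1 h2 h3]
  ring

theorem isL2WeakDeriv_const (ℓ c : ℝ) : IsL2WeakDeriv ℓ (fun _ => c) 0 := by
  refine ⟨MemLp.zero', fun φ h1 h2 h3 => ?_⟩
  have e0 : ∫ x in Ioo 0 ℓ, c * deriv φ x = ∫ x, c * deriv φ x := by
    rw [setIntegral_eq_integral_of_forall_compl_eq_zero]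
    intro x hx
    rw [image_eq_zero_of_notMem_tsupport fun hh => hx (h3 (tsupport_deriv_subset hh)), mul_zero]
  rw [e0, integral_const_mul, integral_eq_zero_of_hasDerivAt_of_integrable
    (f := φ) (f' := deriv φ)]
  · simp
  · exact fun x => (h1.differentiable (by simp) x).hasDerivAt
  · exact (h1.continuous_deriv (by simp)).integrable_of_hasCompactSupport h2.deriv
  · exact h1.continuous.integrable_of_hasCompactSupport h2

theorem MemSobolev.isL2WeakDeriv {ℓ : ℝ} {u : ℝ → ℝ} (h : MemSobolev ℓ u) :
    IsL2WeakDeriv ℓ u (weakDeriv ℓ u) := by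
  rw [weakDeriv, dif_pos h.2]
  exact h.2.choose_spec

theorem L2_inner_toLp {ν : Measure ℝ} {f g : ℝ → ℝ} (hf : MemLp f 2 ν) (hg : MemLp g 2 ν) :
    inner ℝ (hf.toLp f) (hg.toLp g) = ∫ x, f x * g x ∂ν := by
  rw [L2.inner_def]
  refine integral_congr_ae ?_
  filter_upwards [hf.coeFn_toLp, hg.coeFn_toLp] with x h1 h2
  rw [h1, h2, real_inner_eq_re_inner, RCLike.inner_apply]
  simp [mul_comm]

/-- For a fixed test function both sides of the defining identity are `L²` inner products, hence
continuous. This is what makes the energy form closed. -/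
theorem isWeakDeriv_of_tendsto {ℓ : ℝ} {U D : ℕ → Lp ℝ 2 (volume.restrict (Ioo 0 ℓ))}
    {U' D' : Lp ℝ 2 (volume.restrict (Ioo 0 ℓ))} (hU : Tendsto U atTop (𝓝 U'))
    (hD : Tendsto D atTop (𝓝 D')) (h : ∀ n, IsWeakDeriv ℓ (U n) (D n)) :
    IsWeakDeriv ℓ U' D' := by
  have key : ∀ (A : Lp ℝ 2 (volume.restrict (Ioo 0 ℓ))) (f : ℝ → ℝ)
      (hf : MemLp f 2 (volume.restrict (Ioo 0 ℓ))),
      ∫ x in Ioo 0 ℓ, A x * f x = inner ℝ A (hf.toLp f) := by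
    intro A f hf
    rw [← L2_inner_toLp (Lp.memLp A) hf, Lp.toLp_coeFn]
  intro φ h1 h2 h3
  rw [key _ _ (memLp_deriv_test h1 h2 _), key _ _ (memLp_test h1 h2 _)]
  refine tendsto_nhds_unique (hU.inner tendsto_const_nhds)
    ((hD.inner tendsto_const_nhds).neg.congr fun n => ?_)
  have := h n φ h1 h2 h3
  rw [key _ _ (memLp_deriv_test h1 h2 _), key _ _ (memLp_test h1 h2 _)] at this
  exact this.symm

theorem deriv_smoothTransition_eq_zero {y : ℝ} (h : y ≤ 0 ∨ 1 ≤ y) :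
    deriv Real.smoothTransition y = 0 := by
  rcases h with h | h
  · refine IsLocalMin.deriv_eq_zero (Eventually.of_forall fun x => ?_)
    rw [Real.smoothTransition.zero_of_nonpos h]
    exact Real.smoothTransition.nonneg x
  · refine IsLocalMax.deriv_eq_zero (Eventually.of_forall fun x => ?_)
    rw [Real.smoothTransition.one_of_one_le h]
    exact Real.smoothTransition.le_one x

theorem continuous_deriv_smoothTransition : Continuous (deriv Real.smoothTransition) :=
  (Real.smoothTransition.contDiff (n := ⊤)).continuous_deriv (by simp)

theorem hasDerivAt_smoothTransition (y : ℝ) :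
    HasDerivAt Real.smoothTransition (deriv Real.smoothTransition y) y :=
  ((Real.smoothTransition.contDiff (n := ⊤)).differentiable (by simp) y).hasDerivAt

/-- The rescaled derivative is an approximate identity living on `[s, s + ε]`. Substituting `x = s +
ε y` gives an integral over `[0, 1]` that is continuous in `ε` up to `ε = 0`. -/
theorem tendsto_integral_mul_deriv_smoothTransition {u : ℝ → ℝ} (hu : Continuous u) (s : ℝ) :
    Tendsto (fun ε => ∫ x, u x * (deriv Real.smoothTransition ((x - s) / ε) / ε)) (𝓝[>] 0)
      (𝓝 (u s)) := by
  set F : ℝ → ℝ := fun ε => ∫ y in (0 : ℝ)..1, u (s + ε * y) * deriv Real.smoothTransition y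
    with hF
  have hc : Continuous F := by
    apply intervalIntegral.continuous_parametric_intervalIntegral_of_continuous'
    have := continuous_deriv_smoothTransition
    fun_prop
  have h0 : F 0 = u s := by
    simp only [hF, zero_mul, add_zero]
    rw [intervalIntegral.integral_const_mul,
      intervalIntegral.integral_eq_sub_of_hasDerivAt (fun x _ => hasDerivAt_smoothTransition x)
        (continuous_deriv_smoothTransition.intervalIntegrable _ _)]
    simp
  have h1 : Tendsto F (𝓝[>] 0) (𝓝 (u s)) := h0 ▸ (hc.tendsto 0).mono_left nhdsWithin_le_nhds
  refine h1.congr' ?_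
  filter_upwards [self_mem_nhdsWithin] with ε hε
  have hε : 0 < ε := hε
  set f : ℝ → ℝ := fun x => u x * (deriv Real.smoothTransition ((x - s) / ε) / ε)
  have e1 : ∫ x, f x = ∫ x, f (s + x) := (integral_add_left_eq_self f s).symm
  have e2 := Measure.integral_comp_mul_left (fun x => f (s + x)) ε
  rw [abs_of_pos (inv_pos.2 hε), smul_eq_mul] at e2
  have e3 : ∀ y, f (s + ε * y) = ε⁻¹ * (u (s + ε * y) * deriv Real.smoothTransition y) := by
    intro y
    simp only [f]
    rw [show (s + ε * y - s) / ε = y by field_simp; ring]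
    ring
  simp only [e3] at e2
  rw [integral_const_mul] at e2
  rw [e1, ← mul_left_cancel₀ (inv_ne_zero hε.ne') e2]
  refine intervalIntegral.integral_eq_integral_of_support_subset fun y hy => ?_
  by_contra hn
  refine hy ?_
  have : y ≤ 0 ∨ 1 ≤ y := by
    by_contra! h
    exact hn ⟨h.1, h.2.le⟩
  simp [deriv_smoothTransition_eq_zero this]

/-- Test the weak derivative against a smoothed indicator of `[s, t]`. Its derivative is a
difference of two approximate identities and recovers `u s - u t`, while Cauchy–Schwarz bounds the
other side. -/
theorem IsL2WeakDeriv.abs_sub_le {ℓ : ℝ} {u g : ℝ → ℝ} (h : IsL2WeakDeriv ℓ u g)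
    (hu : Continuous u) {s t : ℝ} (hs : 0 < s) (hst : s ≤ t) (ht : t < ℓ) :
    |u s - u t| ≤ √(t - s) * ‖h.memLp.toLp g‖ := by
  let S := Real.smoothTransition
  have hlim := (tendsto_integral_mul_deriv_smoothTransition hu s).sub
    (tendsto_integral_mul_deriv_smoothTransition hu t)
  have hlim2 : Tendsto (fun ε => √(t + ε - s) * ‖h.memLp.toLp g‖) (𝓝[>] 0)
      (𝓝 (√(t - s) * ‖h.memLp.toLp g‖)) := by
    have : Continuous (fun ε => √(t + ε - s) * ‖h.memLp.toLp g‖) := by fun_prop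
    simpa using (this.tendsto 0).mono_left (nhdsWithin_le_nhds (s := Ioi 0))
  refine le_of_tendsto_of_tendsto hlim.abs hlim2 ?_
  -- The test function is supported in `[s, t + ε]`, so `ε < ℓ - t` keeps it inside `(0, ℓ)`.
  filter_upwards [Ioo_mem_nhdsGT (sub_pos.2 ht)] with ε hε
  set φ : ℝ → ℝ := fun x => S ((x - s) / ε) - S ((x - t) / ε) with hφ
  have hS : ContDiff ℝ ∞ S := Real.smoothTransition.contDiff
  have h1 : ContDiff ℝ ∞ φ := by
    refine (hS.comp (by fun_prop)).sub (hS.comp (by fun_prop))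
  have hz : ∀ x, x ∉ Icc s (t + ε) → φ x = 0 := by
    intro x hx
    simp only [mem_Icc, not_and_or, not_le] at hx
    rcases hx with hx | hx
    · simp only [hφ, S]
      rw [Real.smoothTransition.zero_of_nonpos, Real.smoothTransition.zero_of_nonpos, sub_zero]
      · exact div_nonpos_of_nonpos_of_nonneg (by linarith) hε.1.le
      · exact div_nonpos_of_nonpos_of_nonneg (by linarith) hε.1.le
    · simp only [hφ, S]
      rw [Real.smoothTransition.one_of_one_le, Real.smoothTransition.one_of_one_le, sub_self]
      · rw [le_div_iff₀ hε.1]; linarith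
      · rw [le_div_iff₀ hε.1]; linarith
  have hsup : tsupport φ ⊆ Icc s (t + ε) :=
    closure_minimal (fun x hx => by_contra fun hn => hx (hz x hn)) isClosed_Icc
  have h2 : HasCompactSupport φ := isCompact_Icc.of_isClosed_subset (isClosed_tsupport _) hsup
  have h3 : tsupport φ ⊆ Ioo 0 ℓ := fun x hx =>
    ⟨hs.trans_le (hsup hx).1, (hsup hx).2.trans_lt (by linarith [hε.2])⟩
  have hd : ∀ a x, HasDerivAt (fun x => S ((x - a) / ε)) (deriv S ((x - a) / ε) / ε) x := by
    intro a x
    have := (hasDerivAt_smoothTransition ((x - a) / ε)).comp x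
      (((hasDerivAt_id x).sub_const a).div_const ε)
    rw [div_eq_mul_one_div]
    exact this
  have hdφ : deriv φ = fun x => deriv S ((x - s) / ε) / ε - deriv S ((x - t) / ε) / ε :=
    funext fun x => ((hd s x).sub (hd t x)).deriv
  have hi : ∀ a, Integrable (fun x => u x * (deriv S ((x - a) / ε) / ε)) := by
    intro a
    have hS' : Continuous (deriv S) := continuous_deriv_smoothTransition
    refine Continuous.integrable_of_hasCompactSupport (by fun_prop) ?_
    refine HasCompactSupport.of_support_subset_isCompact (isCompact_Icc (a := a) (b := a + ε)) ?_
    intro x hx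
    by_contra hn
    refine hx ?_
    have : (x - a) / ε ≤ 0 ∨ 1 ≤ (x - a) / ε := by
      simp only [mem_Icc, not_and_or, not_le] at hn
      rcases hn with hn | hn
      · exact Or.inl (div_nonpos_of_nonpos_of_nonneg (by linarith) hε.1.le)
      · right; rw [le_div_iff₀ hε.1]; linarith
    simp only [S, deriv_smoothTransition_eq_zero this, zero_div, mul_zero]
  have e1 : (∫ x, u x * (deriv S ((x - s) / ε) / ε)) - ∫ x, u x * (deriv S ((x - t) / ε) / ε)
      = ∫ x in Ioo 0 ℓ, u x * deriv φ x := by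
    rw [setIntegral_eq_integral_of_forall_compl_eq_zero]
    · rw [← integral_sub (hi s) (hi t), hdφ]
      simp only [mul_sub]
    · intro x hx
      rw [image_eq_zero_of_notMem_tsupport fun hh => hx (h3 (tsupport_deriv_subset hh)),
        mul_zero]
  change |(∫ x, u x * (deriv S ((x - s) / ε) / ε)) -
    ∫ x, u x * (deriv S ((x - t) / ε) / ε)| ≤ _
  rw [e1, h.2 φ h1 h2 h3, abs_neg]
  have hφL := memLp_test h1 h2 (Ioo 0 ℓ)
  rw [← L2_inner_toLp h.memLp hφL]
  refine (abs_real_inner_le_norm _ _).trans ?_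
  rw [mul_comm]
  refine mul_le_mul_of_nonneg_right ?_ (norm_nonneg _)
  refine Real.le_sqrt_of_sq_le ?_
  rw [← real_inner_self_eq_norm_sq, L2_inner_toLp hφL hφL]
  have hle : ∀ x, φ x * φ x ≤ (Icc s (t + ε)).indicator (fun _ => (1 : ℝ)) x := by
    intro x
    by_cases hx : x ∈ Icc s (t + ε)
    · rw [indicator_of_mem hx]
      have a1 : φ x ≤ 1 := by
        have := Real.smoothTransition.le_one ((x - s) / ε)
        have := Real.smoothTransition.nonneg ((x - t) / ε)
        simp only [hφ, S]; linarith
      have a2 : 0 ≤ φ x := by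
        refine sub_nonneg.2 (Real.smoothTransition.monotone ?_)
        exact div_le_div_of_nonneg_right (by linarith) hε.1.le
      nlinarith
    · rw [indicator_of_notMem hx, hz x hx, mul_zero]
  have hii : Integrable ((Icc s (t + ε)).indicator (fun _ => (1 : ℝ))) :=
    (integrable_indicator_iff measurableSet_Icc).2 (by simp)
  calc ∫ x in Ioo 0 ℓ, φ x * φ x
      ≤ ∫ x in Ioo 0 ℓ, (Icc s (t + ε)).indicator (fun _ => (1 : ℝ)) x :=
        integral_mono (hφL.integrable_mul hφL) hii.integrableOn hle
    _ ≤ ∫ x, (Icc s (t + ε)).indicator (fun _ => (1 : ℝ)) x :=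
        setIntegral_le_integral hii (Eventually.of_forall fun x =>
          indicator_nonneg (fun _ _ => zero_le_one) x)
    _ = t + ε - s := by
        rw [integral_indicator measurableSet_Icc]
        simp
        linarith [hε.1]

theorem IsL2WeakDeriv.abs_sub_le_of_mem_Icc {ℓ : ℝ} {u g : ℝ → ℝ} (h : IsL2WeakDeriv ℓ u g)
    (hu : Continuous u) (hℓ : 0 < ℓ) {s t : ℝ} (hs : s ∈ Icc 0 ℓ) (ht : t ∈ Icc 0 ℓ) :
    |u s - u t| ≤ √|t - s| * ‖h.memLp.toLp g‖ := by
  have hcl : Icc 0 ℓ ×ˢ Icc 0 ℓ ⊆ closure (Ioo 0 ℓ ×ˢ Ioo 0 ℓ) := by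
    rw [closure_prod_eq, closure_Ioo hℓ.ne]
  have hclosed : IsClosed {p : ℝ × ℝ | |u p.1 - u p.2| ≤ √|p.2 - p.1| * ‖h.memLp.toLp g‖} :=
    isClosed_le (by fun_prop) (by fun_prop)
  refine (hcl.trans (closure_minimal ?_ hclosed)) (show (s, t) ∈ Icc 0 ℓ ×ˢ Icc 0 ℓ from ⟨hs, ht⟩)
  rintro ⟨a, b⟩ ⟨ha, hb⟩
  rcases le_total a b with hab | hab
  · simpa [abs_of_nonneg (sub_nonneg.2 hab)] using h.abs_sub_le hu ha.1 hab hb.2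
  · have := h.abs_sub_le hu hb.1 hab ha.2
    rw [abs_sub_comm] at this
    simpa [abs_of_nonpos (sub_nonpos.2 hab)] using this

end Sobolev

/-! ### The metric graph as a compact metrizable space -/

namespace MetricGraph

variable {V E : Type*} (G : MetricGraph V E)

/-- The point of the metric realization given by a vertex. -/
def vertex (v : V) : G.Space := Quot.mk _ (Sum.inl v)

theorem edgePoint_coe (e : E) (t : Icc (0 : ℝ) (G.len e)) :
    G.edgePoint e t = Quot.mk _ (Sum.inr ⟨e, t⟩) := by
  rw [edgePoint, projIcc_val]
  rfl

theorem edgePoint_zero (e : E) : G.edgePoint e 0 = G.vertex (G.src e) := by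
  rw [edgePoint, projIcc_left]
  exact Quot.sound (Glue.src e)

theorem edgePoint_len (e : E) : G.edgePoint e (G.len e) = G.vertex (G.tgt e) := by
  rw [edgePoint, projIcc_right]
  exact Quot.sound (Glue.tgt e)

theorem exists_vertex_or_edgePoint (x : G.Space) :
    (∃ v, x = G.vertex v) ∨ ∃ e, ∃ t ∈ Ioo 0 (G.len e), x = G.edgePoint e t := by
  obtain ⟨y, rfl⟩ := Quot.exists_rep x
  rcases y with v | ⟨e, t⟩
  · exact Or.inl ⟨v, rfl⟩
  · have key : (∃ v, G.edgePoint e t = G.vertex v) ∨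
        ∃ e', ∃ s ∈ Ioo 0 (G.len e'), G.edgePoint e t = G.edgePoint e' s := by
      rcases eq_or_lt_of_le t.2.1 with h | h
      · exact Or.inl ⟨_, by rw [← h]; exact G.edgePoint_zero e⟩
      · rcases eq_or_lt_of_le t.2.2 with h' | h'
        · exact Or.inl ⟨_, by rw [h']; exact G.edgePoint_len e⟩
        · exact Or.inr ⟨e, t, ⟨h, h'⟩, rfl⟩
    rw [edgePoint_coe] at key
    exact key

theorem continuous_edgePoint (e : E) : Continuous (G.edgePoint e) := by
  let _ : TopologicalSpace V := ⊥
  have h1 : Continuous (fun t : Icc (0 : ℝ) (G.len e) =>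
      (Sum.inr ⟨e, t⟩ : V ⊕ (Σ e : E, Icc (0 : ℝ) (G.len e)))) :=
    continuous_inr.comp continuous_sigmaMk
  have h2 : Continuous (Quot.mk G.Glue : G.Pre → G.Space) := continuous_quot_mk
  have h3 : Continuous (fun t : Icc (0 : ℝ) (G.len e) =>
    (Quot.mk G.Glue (Sum.inr ⟨e, t⟩) : G.Space)) := h2.comp h1
  exact h3.comp continuous_projIcc

theorem continuous_of_forall_edge {Z : Type*} [TopologicalSpace Z] {f : G.Space → Z}
    (h : ∀ e, Continuous fun t : Icc (0 : ℝ) (G.len e) => f (G.edgePoint e t)) :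
    Continuous f := by
  let _ : TopologicalSpace V := ⊥
  have : DiscreteTopology V := ⟨rfl⟩
  have h2 : Continuous fun y : V ⊕ (Σ e : E, Icc (0 : ℝ) (G.len e)) =>
      f (Quot.mk G.Glue y) := by
    refine continuous_sum_dom.2 ⟨continuous_of_discreteTopology, continuous_sigma fun e => ?_⟩
    refine (h e).congr fun t => ?_
    rw [edgePoint_coe]
    rfl
  exact (isQuotientMap_quot_mk (r := G.Glue)).continuous_iff.2 h2

/-- Equicontinuity is continuity of `x ↦ (F i x)_i` for the topology of uniform convergence, so the
universal property of the quotient applies. -/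
theorem equicontinuous_of_forall_edge {ι : Type*} {F : ι → G.Space → ℝ}
    (h : ∀ e, Equicontinuous fun i (t : Icc (0 : ℝ) (G.len e)) => F i (G.edgePoint e t)) :
    Equicontinuous F := by
  rw [equicontinuous_iff_continuous]
  exact G.continuous_of_forall_edge fun e => equicontinuous_iff_continuous.1 (h e)

instance [Finite V] [Finite E] : CompactSpace G.Space := by
  let _ : TopologicalSpace V := ⊥
  have : CompactSpace G.Pre :=
    inferInstanceAs (CompactSpace (V ⊕ (Σ e : E, Icc (0 : ℝ) (G.len e))))
  exact inferInstanceAs (CompactSpace (Quot G.Glue))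

/-- The map on the metric realization given by compatible maps on vertices and edges. -/
def glue {Z : Type*} (F : V → Z) (h : E → ℝ → Z) (h0 : ∀ e, h e 0 = F (G.src e))
    (h1 : ∀ e, h e (G.len e) = F (G.tgt e)) : G.Space → Z :=
  Quot.lift (Sum.elim F fun p => h p.1 p.2) (by rintro _ _ (e | e) <;> simp [h0, h1])

open Classical in
/-- An injective continuous map from the metric realization to a Euclidean space. -/
noncomputable def coordinates : G.Space → (E → ℝ) × (E → ℝ) × (V → ℝ) :=
  G.glue (fun v => (0, 0, Pi.single v 1))
    (fun e t => (Pi.single e (1 - Real.cos (2 * Real.pi * t / G.len e)),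
      Pi.single e (Real.sin (2 * Real.pi * t / G.len e)),
      (1 - t / G.len e) • Pi.single (G.src e) 1 + (t / G.len e) • Pi.single (G.tgt e) 1))
    (fun e => by simp)
    (fun e => by
      have := (G.len_pos e).ne'
      simp [this])

open Classical in
theorem coordinates_edgePoint (e : E) (t : Icc (0 : ℝ) (G.len e)) :
    G.coordinates (G.edgePoint e t) = (Pi.single e (1 - Real.cos (2 * Real.pi * t / G.len e)),
      Pi.single e (Real.sin (2 * Real.pi * t / G.len e)),
      (1 - (t : ℝ) / G.len e) • Pi.single (G.src e) 1 +
        ((t : ℝ) / G.len e) • Pi.single (G.tgt e) 1) := by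
  rw [edgePoint_coe]
  rfl

theorem continuous_coordinates : Continuous G.coordinates := by
  classical
  refine G.continuous_of_forall_edge fun e => ?_
  simp only [coordinates_edgePoint]
  have h1 : Continuous fun x : ℝ => (Pi.single e x : E → ℝ) := continuous_single (A := fun _ => ℝ) e
  refine (h1.comp (by fun_prop)).prodMk ((h1.comp (by fun_prop)).prodMk (by fun_prop))

/-- Each edge runs once around a circle through the origin in a plane of its own, given by the first
two factors. Only vertices sit at the origin, and the third factor separates them; along an edge it
interpolates linearly, so that the map respects the gluing. -/
theorem injective_coordinates : Function.Injective G.coordinates := by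
  classical
  have hv : ∀ v, G.coordinates (G.vertex v) = (0, 0, Pi.single v 1) := fun v => rfl
  have hpi := Real.pi_pos
  have hc : ∀ e, ∀ t ∈ Ioo 0 (G.len e), 1 - Real.cos (2 * Real.pi * t / G.len e) ≠ 0 := by
    intro e t ht h0
    have hl := G.len_pos e
    have hb : 2 * Real.pi * t / G.len e < 2 * Real.pi := by
      rw [div_lt_iff₀ hl]
      exact mul_lt_mul_of_pos_left ht.2 (by positivity)
    have hp : 0 < 2 * Real.pi * t / G.len e := by
      have := ht.1
      positivity
    exact hp.ne' ((Real.cos_eq_one_iff_of_lt_of_lt (by linarith) hb).1 (by linarith))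
  have hve : ∀ v e, ∀ t ∈ Ioo 0 (G.len e),
      G.coordinates (G.vertex v) ≠ G.coordinates (G.edgePoint e t) := by
    intro v e t ht h
    rw [hv, G.coordinates_edgePoint e ⟨t, ht.1.le, ht.2.le⟩, Prod.mk.injEq] at h
    have := congrFun h.1 e
    simp only [Pi.zero_apply, Pi.single_eq_same] at this
    exact hc e t ht this.symm
  intro x y hxy
  rcases G.exists_vertex_or_edgePoint x with ⟨v, rfl⟩ | ⟨e, t, ht, rfl⟩ <;>
    rcases G.exists_vertex_or_edgePoint y with ⟨w, rfl⟩ | ⟨e', t', ht', rfl⟩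
  · rw [hv, hv, Prod.mk.injEq, Prod.mk.injEq] at hxy
    have := congrFun hxy.2.2 v
    by_contra hne
    have hne' : v ≠ w := fun h => hne (by rw [h])
    simp [Pi.single_eq_of_ne hne'] at this
  · exact absurd hxy (hve _ _ _ ht')
  · exact absurd hxy.symm (hve _ _ _ ht)
  · rw [G.coordinates_edgePoint e ⟨t, ht.1.le, ht.2.le⟩,
      G.coordinates_edgePoint e' ⟨t', ht'.1.le, ht'.2.le⟩, Prod.mk.injEq, Prod.mk.injEq] at hxy
    have h1 := congrFun hxy.1 e
    obtain rfl : e = e' := by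
      by_contra hne
      rw [Pi.single_eq_same, Pi.single_eq_of_ne hne] at h1
      exact hc e t ht h1
    have h2 := congrFun hxy.2.1 e
    rw [Pi.single_eq_same, Pi.single_eq_same] at h1 h2
    simp only at h1 h2
    have h1 : Real.cos (2 * Real.pi * t / G.len e) = Real.cos (2 * Real.pi * t' / G.len e) := by
      linarith
    have hl := G.len_pos e
    have hone : Real.cos (2 * Real.pi * t / G.len e - 2 * Real.pi * t' / G.len e) = 1 := by
      rw [Real.cos_sub, h1, h2]
      nlinarith [Real.sin_sq_add_cos_sq (2 * Real.pi * t' / G.len e)]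
    have hb : ∀ s ∈ Ioo 0 (G.len e), 2 * Real.pi * s / G.len e ∈ Ioo 0 (2 * Real.pi) := by
      intro s hs
      have := hs.1
      refine ⟨by positivity, ?_⟩
      rw [div_lt_iff₀ hl]
      exact mul_lt_mul_of_pos_left hs.2 (by positivity)
    have b1 := hb t ht
    have b2 := hb t' ht'
    have := (Real.cos_eq_one_iff_of_lt_of_lt (by linarith [b1.1, b2.2])
      (by linarith [b1.2, b2.1])).1 hone
    have h3 : t = t' := by
      field_simp at this
      have h5 : 0 < 2 * Real.pi := by positivity
      rw [mul_zero] at this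
      exact sub_eq_zero.1 ((mul_eq_zero.1 this).resolve_left h5.ne')
    rw [h3]

theorem isClosedEmbedding_coordinates [Finite V] [Finite E] :
    IsClosedEmbedding G.coordinates :=
  G.continuous_coordinates.isClosedEmbedding G.injective_coordinates

instance [Finite V] [Finite E] : TopologicalSpace.MetrizableSpace G.Space :=
  have := Fintype.ofFinite V
  have := Fintype.ofFinite E
  G.isClosedEmbedding_coordinates.isEmbedding.metrizableSpace

instance [Finite V] [Finite E] : SecondCountableTopology G.Space :=
  G.isClosedEmbedding_coordinates.isEmbedding.secondCountableTopology

instance : Nonempty G.Space := ⟨G.vertex G.nonempty.some⟩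

end MetricGraph

/-- The first-order condition at a minimum, from which the Euler–Lagrange equations are read off. -/
theorem eq_zero_of_forall_quadratic_nonneg {b d : ℝ} (h : ∀ t : ℝ, 0 ≤ 2 * t * b + t ^ 2 * d) :
    b = 0 := by
  by_contra hb
  have hd : 0 ≤ d := by
    have h1 := h 1
    have h2 := h (-1)
    linarith
  -- The minimiser would be `-b / d`; the shift by one avoids `d = 0` and still gives a negative
  -- value.
  have := h (-b / (d + 1))
  have hd1 : 0 < d + 1 := by linarith
  have e : 2 * (-b / (d + 1)) * b + (-b / (d + 1)) ^ 2 * d =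
      -(b ^ 2 * (d + 2)) / (d + 1) ^ 2 := by
    field_simp
    ring
  rw [e] at this
  have hb2 : 0 < b ^ 2 * (d + 2) := by positivity
  have : -(b ^ 2 * (d + 2)) / (d + 1) ^ 2 < 0 := div_neg_of_neg_of_pos (by linarith) (by positivity)
  linarith

/-! ### The mass form of a finite measure -/

section MassForm

variable {S : Type*} [TopologicalSpace S] [CompactSpace S] [MeasurableSpace S]

theorem abs_integral_le_norm (μ : Measure S) [IsFiniteMeasure μ] (f : C(S, ℝ)) :
    |∫ x, f x ∂μ| ≤ ‖f‖ * μ.real univ :=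
  norm_integral_le_of_norm_le_const (Eventually.of_forall fun x => f.norm_coe_le_norm x)

variable [OpensMeasurableSpace S]

theorem ContinuousMap.integrable_of_finite (μ : Measure S) [IsFiniteMeasure μ] (f : C(S, ℝ)) :
    Integrable f μ :=
  (BoundedContinuousFunction.mkOfCompact f).integrable μ

theorem ContinuousMap.memLp_two_of_finite (μ : Measure S) [IsFiniteMeasure μ] (f : C(S, ℝ)) :
    MemLp f 2 μ :=
  (memLp_two_iff_integrable_sq (f.integrable_of_finite μ).1).2 ((f ^ 2).integrable_of_finite μ)

/-- The bilinear form `(f, g) ↦ ∫ f g dμ` on continuous functions. -/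
noncomputable def massForm (μ : Measure S) [IsFiniteMeasure μ] : LinearMap.BilinForm ℝ C(S, ℝ) :=
  LinearMap.mk₂ ℝ (fun f g => ∫ x, f x * g x ∂μ)
    (fun f f' g => by
      have h1 := (f * g).integrable_of_finite μ
      have h2 := (f' * g).integrable_of_finite μ
      simp only [ContinuousMap.add_apply, add_mul]
      exact integral_add h1 h2)
    (fun c f g => by
      simp only [ContinuousMap.smul_apply, smul_eq_mul, mul_assoc]
      exact integral_const_mul _ _)
    (fun f g g' => by
      have h1 := (f * g).integrable_of_finite μ
      have h2 := (f * g').integrable_of_finite μ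
      simp only [ContinuousMap.add_apply, mul_add]
      exact integral_add h1 h2)
    (fun c f g => by
      simp only [ContinuousMap.smul_apply, smul_eq_mul, mul_left_comm _ c]
      exact integral_const_mul _ _)

theorem massForm_apply (μ : Measure S) [IsFiniteMeasure μ] (f g : C(S, ℝ)) :
    massForm μ f g = ∫ x, f x * g x ∂μ := rfl

theorem massForm_comm (μ : Measure S) [IsFiniteMeasure μ] (f g : C(S, ℝ)) :
    massForm μ f g = massForm μ g f := by
  simp only [massForm_apply, mul_comm]

theorem massForm_self_nonneg (μ : Measure S) [IsFiniteMeasure μ] (f : C(S, ℝ)) :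
    0 ≤ massForm μ f f :=
  integral_nonneg fun x => mul_self_nonneg (f x)

theorem abs_massForm_le (μ : Measure S) [IsFiniteMeasure μ] (f g : C(S, ℝ)) :
    |massForm μ f g| ≤ ‖f‖ * ‖g‖ * μ.real univ :=
  (abs_integral_le_norm μ (f * g)).trans
    (mul_le_mul_of_nonneg_right (norm_mul_le f g) measureReal_nonneg)

/-- Replacing `f i * g i` by the fixed function `f' * g'` costs at most its uniform distance times
the convergent masses; weak-* convergence handles the rest. -/
theorem tendsto_massForm_of_tendsto {ι : Type*} {l : Filter ι} {μs : ι → FiniteMeasure S}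
    {μ : FiniteMeasure S} (hμ : Tendsto μs l (𝓝 μ)) {f g : ι → C(S, ℝ)} {f' g' : C(S, ℝ)}
    (hf : Tendsto f l (𝓝 f')) (hg : Tendsto g l (𝓝 g')) :
    Tendsto (fun i => massForm (μs i : Measure S) (f i) (g i)) l
      (𝓝 (massForm (μ : Measure S) f' g')) := by
  have hfg : Tendsto (fun i => f i * g i - f' * g') l (𝓝 0) := by
    simpa using (hf.mul hg).sub_const (f' * g')
  have hmass : Tendsto (fun i => (μs i : Measure S).real univ) l
      (𝓝 ((μ : Measure S).real univ)) :=
    (NNReal.continuous_coe.tendsto _).comp ((FiniteMeasure.continuous_mass.tendsto _).comp hμ)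
  have h1 : Tendsto (fun i => ∫ x, (f i * g i - f' * g') x ∂(μs i : Measure S)) l (𝓝 0) := by
    refine squeeze_zero_norm (fun i => abs_integral_le_norm _ _) ?_
    simpa using hfg.norm.mul hmass
  have h2 := FiniteMeasure.tendsto_iff_forall_integral_tendsto.1 hμ
    (BoundedContinuousFunction.mkOfCompact (f' * g'))
  have h3 := h1.add h2
  rw [zero_add] at h3
  refine h3.congr fun i => ?_
  have e : ∫ x, (f i * g i - f' * g') x ∂(μs i : Measure S) =
      ∫ x, (f i * g i) x ∂(μs i : Measure S) - ∫ x, (f' * g') x ∂(μs i : Measure S) :=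
    integral_sub ((f i * g i).integrable_of_finite _) ((f' * g').integrable_of_finite _)
  rw [e]
  exact sub_add_cancel _ _

end MassForm

/-- A nonnegative symmetric bilinear form on a space of continuous functions that controls the
oscillation, is closed, and has relatively compact balls. -/
structure EnergySpace (S : Type*) [TopologicalSpace S] [CompactSpace S] where
  dom : Submodule ℝ C(S, ℝ)
  form : LinearMap.BilinForm ℝ dom
  symm : ∀ f g, form f g = form g f
  nonneg : ∀ f, 0 ≤ form f f
  bound : ℝ
  bound_nonneg : 0 ≤ bound
  abs_sub_le : ∀ (f : dom) (x y : S), |(f : C(S, ℝ)) x - (f : C(S, ℝ)) y| ≤ bound * √(form f f)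
  complete : ∀ (f : ℕ → dom) (g : C(S, ℝ)), Tendsto (fun n => (f n : C(S, ℝ))) atTop (𝓝 g) →
    (∀ ε > 0, ∃ N, ∀ m ≥ N, ∀ n ≥ N, form (f m - f n) (f m - f n) < ε) →
    ∃ h : dom, (h : C(S, ℝ)) = g ∧ Tendsto (fun n => form (f n - h) (f n - h)) atTop (𝓝 0)
  compact : ∀ M : ℝ, IsCompact (closure {g : C(S, ℝ) | ∃ f : dom, (f : C(S, ℝ)) = g ∧
    form f f ≤ M ∧ ‖g‖ ≤ M})

/-! ### Energy spaces and the Dirichlet principle -/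

namespace EnergySpace

variable {S : Type*} [TopologicalSpace S] [CompactSpace S] (A : EnergySpace S)

theorem form_sq_le (f g : A.dom) : A.form f g ^ 2 ≤ A.form f f * A.form g g :=
  LinearMap.BilinForm.apply_sq_le_of_symm A.form A.nonneg ⟨fun f g => A.symm f g⟩ f g

theorem tendsto_form_of_tendsto {f : ℕ → A.dom} {h : A.dom}
    (hf : Tendsto (fun n => A.form (f n - h) (f n - h)) atTop (𝓝 0)) (φ : A.dom) :
    Tendsto (fun n => A.form (f n) φ) atTop (𝓝 (A.form h φ)) := by
  have h1 : Tendsto (fun n => A.form (f n - h) φ ^ 2) atTop (𝓝 0) := by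
    refine squeeze_zero (fun n => sq_nonneg _) (fun n => A.form_sq_le _ _) ?_
    simpa using hf.mul_const (A.form φ φ)
  have h2 : Tendsto (fun n => A.form (f n - h) φ) atTop (𝓝 0) := by
    have := (Real.continuous_sqrt.tendsto 0).comp h1
    simp only [Real.sqrt_zero, Function.comp_def, Real.sqrt_sq_eq_abs] at this
    exact (tendsto_zero_iff_abs_tendsto_zero _).2 this
  have h3 := h2.add_const (A.form h φ)
  rw [zero_add] at h3
  refine h3.congr fun n => ?_
  rw [map_sub, LinearMap.sub_apply, sub_add_cancel]

theorem tendsto_form_self_of_tendsto {f : ℕ → A.dom} {h : A.dom}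
    (hf : Tendsto (fun n => A.form (f n - h) (f n - h)) atTop (𝓝 0)) :
    Tendsto (fun n => A.form (f n) (f n)) atTop (𝓝 (A.form h h)) := by
  have h1 := (hf.add ((A.tendsto_form_of_tendsto hf h).const_mul 2)).sub_const (A.form h h)
  rw [show (0 + 2 * A.form h h - A.form h h) = A.form h h by ring] at h1
  refine h1.congr fun n => ?_
  simp only [map_sub, LinearMap.sub_apply]
  rw [A.symm h (f n)]
  ring

theorem form_sub_add_form_add (f g : A.dom) : A.form (f - g) (f - g) + A.form (f + g) (f + g) =
    2 * A.form f f + 2 * A.form g g := by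
  simp only [map_sub, map_add, LinearMap.sub_apply, LinearMap.add_apply]
  ring

/-- Every function has a harmonic modification off a nonempty set. -/
theorem exists_harmonic_extension {K : Set S} (hK : K.Nonempty) (φ : A.dom) :
    ∃ ψ : A.dom, (∀ x ∈ K, (ψ : C(S, ℝ)) x = (φ : C(S, ℝ)) x) ∧
      ∀ g : A.dom, (∀ x ∈ K, (g : C(S, ℝ)) x = 0) → A.form ψ g = 0 := by
  obtain ⟨x₀, hx₀⟩ := hK
  set P : Set A.dom := {ψ | ∀ x ∈ K, (ψ : C(S, ℝ)) x = (φ : C(S, ℝ)) x} with hP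
  set R : Set ℝ := (fun ψ => A.form ψ ψ) '' P with hR
  have hne : R.Nonempty := ⟨_, φ, fun x _ => rfl, rfl⟩
  have hbdd : BddBelow R := ⟨0, by rintro _ ⟨ψ, _, rfl⟩; exact A.nonneg ψ⟩
  set a := sInf R
  have hmin : ∀ ψ ∈ P, a ≤ A.form ψ ψ := fun ψ hψ => csInf_le hbdd ⟨ψ, hψ, rfl⟩
  obtain ⟨r, -, hr, hrR⟩ := exists_seq_tendsto_sInf hne hbdd
  choose f hfP hfr using hrR
  -- A minimising sequence is Cauchy in energy: midpoints are competitors too, so the parallelogram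
  -- law bounds the differences.
  have hcauchy : ∀ ε > 0, ∃ N, ∀ m ≥ N, ∀ n ≥ N, A.form (f m - f n) (f m - f n) < ε := by
    intro ε hε
    obtain ⟨N, hN⟩ := eventually_atTop.1 (hr.eventually_lt_const (show a < a + ε / 4 by linarith))
    refine ⟨N, fun m hm n hn => ?_⟩
    have h1 := A.form_sub_add_form_add (f m) (f n)
    have h2 : a ≤ A.form ((1 / 2 : ℝ) • (f m + f n)) ((1 / 2 : ℝ) • (f m + f n)) := by
      refine hmin _ fun x hx => ?_
      have e1 := hfP m x hx
      have e2 := hfP n x hx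
      simp only [Submodule.coe_smul, Submodule.coe_add, ContinuousMap.smul_apply,
        ContinuousMap.add_apply, smul_eq_mul, e1, e2]
      ring
    rw [map_smul, map_smul, LinearMap.smul_apply, smul_eq_mul, smul_eq_mul] at h2
    have h3 := hN m hm
    have h4 := hN n hn
    rw [← hfr] at h3 h4
    linarith
  -- All differences vanish at `x₀ ∈ K`, so the oscillation bound turns Cauchy in energy into
  -- uniformly Cauchy. The constant is enlarged by one because `A.bound` may be zero.
  have hunif : CauchySeq fun n => (f n : C(S, ℝ)) := by
    refine Metric.cauchySeq_iff.2 fun ε hε => ?_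
    have hC : 0 < A.bound + 1 := by linarith [A.bound_nonneg]
    obtain ⟨N, hN⟩ := hcauchy ((ε / (A.bound + 1)) ^ 2) (by positivity)
    refine ⟨N, fun m hm n hn => ?_⟩
    have h1 : √(A.form (f m - f n) (f m - f n)) < ε / (A.bound + 1) := by
      rw [Real.sqrt_lt' (by positivity)]
      exact hN m hm n hn
    have h2 : A.bound * √(A.form (f m - f n) (f m - f n)) < ε := by
      calc A.bound * √(A.form (f m - f n) (f m - f n))
          ≤ (A.bound + 1) * √(A.form (f m - f n) (f m - f n)) :=
            mul_le_mul_of_nonneg_right (by linarith) (Real.sqrt_nonneg _)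
        _ < (A.bound + 1) * (ε / (A.bound + 1)) := mul_lt_mul_of_pos_left h1 hC
        _ = ε := mul_div_cancel₀ _ hC.ne'
    refine lt_of_le_of_lt ?_ h2
    rw [ContinuousMap.dist_le (mul_nonneg A.bound_nonneg (Real.sqrt_nonneg _))]
    intro x
    have h3 := A.abs_sub_le (f m - f n) x x₀
    simp only [Submodule.coe_sub, ContinuousMap.sub_apply, hfP m x₀ hx₀, hfP n x₀ hx₀, sub_self,
      sub_zero] at h3
    exact h3
  obtain ⟨g, hg⟩ := cauchySeq_tendsto_of_complete hunif
  obtain ⟨h, rfl, hh⟩ := A.complete f g hg hcauchy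
  have hhP : h ∈ P := by
    intro x hx
    refine tendsto_nhds_unique ((((ContinuousEvalConst.continuous_eval_const x).tendsto _).comp hg)) ?_
    refine tendsto_const_nhds.congr fun n => (hfP n x hx).symm
  have hha : A.form h h = a := by
    refine tendsto_nhds_unique (A.tendsto_form_self_of_tendsto hh) (hr.congr fun n => (hfr n).symm)
  refine ⟨h, hhP, fun g hg => ?_⟩
  refine eq_zero_of_forall_quadratic_nonneg (d := A.form g g) fun t => ?_
  have h1 := hmin (h + t • g) (fun x hx => by simp [hhP x hx, hg x hx])
  simp only [map_add, map_smul, LinearMap.add_apply, LinearMap.smul_apply, smul_eq_mul] at h1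
  rw [A.symm g h] at h1
  linarith

/-! ### Eigenfamilies and minimisation of the Rayleigh quotient -/

section Measure

variable [MeasurableSpace S] [OpensMeasurableSpace S]

/-- Integrate `f(x)² ≤ 2 (f(x) - f(y))² + 2 f(y)²` over `y`, with the oscillation bound for the
first term. -/
theorem mass_mul_sq_le (μ : Measure S) [IsFiniteMeasure μ] (f : A.dom) (x : S) :
    μ.real univ * (f : C(S, ℝ)) x ^ 2 ≤
      2 * A.bound ^ 2 * A.form f f * μ.real univ + 2 * massForm μ f f := by
  have h1 : ∀ y, (f : C(S, ℝ)) x ^ 2 ≤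
      2 * A.bound ^ 2 * A.form f f + 2 * ((f : C(S, ℝ)) y * (f : C(S, ℝ)) y) := by
    intro y
    have h2 := A.abs_sub_le f x y
    have h3 : ((f : C(S, ℝ)) x - (f : C(S, ℝ)) y) ^ 2 ≤ A.bound ^ 2 * A.form f f := by
      rw [← sq_abs, ← Real.sq_sqrt (A.nonneg f), ← mul_pow]
      exact pow_le_pow_left₀ (abs_nonneg _) h2 2
    nlinarith [sq_nonneg ((f : C(S, ℝ)) x - 2 * (f : C(S, ℝ)) y)]
  have hi : Integrable (fun y => 2 * ((f : C(S, ℝ)) y * (f : C(S, ℝ)) y)) μ :=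
    (((f : C(S, ℝ)) * (f : C(S, ℝ))).integrable_of_finite μ).const_mul 2
  have h4 := integral_mono (μ := μ) (integrable_const _) ((integrable_const _).add hi) h1
  rw [integral_const, integral_add' (integrable_const _) hi, integral_const,
    integral_const_mul] at h4
  rw [massForm_apply]
  simp only [smul_eq_mul] at h4
  linarith

/-- The bound depends on the measure only through the mass form and a lower bound for the total
mass, hence is uniform along a sequence with nonzero limit. -/
theorem norm_le_of_mass (μ : Measure S) [IsFiniteMeasure μ] {δ : ℝ} (hδ : 0 < δ)
    (hμ : δ ≤ μ.real univ) (f : A.dom) :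
    ‖(f : C(S, ℝ))‖ ≤ √(2 * A.bound ^ 2 * A.form f f + 2 * massForm μ f f / δ) := by
  rw [ContinuousMap.norm_le _ (Real.sqrt_nonneg _)]
  intro x
  refine Real.le_sqrt_of_sq_le ?_
  rw [Real.norm_eq_abs, sq_abs]
  have h1 := A.mass_mul_sq_le μ f x
  have hm : 0 < μ.real univ := hδ.trans_le hμ
  have h2 : (f : C(S, ℝ)) x ^ 2 ≤
      2 * A.bound ^ 2 * A.form f f + 2 * massForm μ f f / μ.real univ := by
    rw [← mul_le_mul_iff_right₀ hm, mul_add, mul_div_cancel₀ _ hm.ne']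
    linarith
  refine h2.trans ?_
  have := massForm_self_nonneg μ (f : C(S, ℝ))
  gcongr

/-- An `L²(μ)`-orthonormal family of solutions of the eigenvalue equations. -/
def IsEigenfamily (μ : Measure S) [IsFiniteMeasure μ] {n : ℕ} (a : Fin n → ℝ)
    (v : Fin n → A.dom) : Prop :=
  (∀ j φ, A.form (v j) φ = a j * massForm μ (v j) φ) ∧
    ∀ i j, massForm μ (v i) (v j) = if i = j then 1 else 0

/-- There are at least `n` eigenvalues `≤ Λ`, counted with multiplicity. -/
def HasEigenfamily (μ : Measure S) [IsFiniteMeasure μ] (Λ : ℝ) (n : ℕ) : Prop :=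
  ∃ (a : Fin n → ℝ) (v : Fin n → A.dom), A.IsEigenfamily μ a v ∧ ∀ j, a j ≤ Λ

variable {A}

theorem IsEigenfamily.form_self {μ : Measure S} [IsFiniteMeasure μ] {n : ℕ} {a : Fin n → ℝ}
    {v : Fin n → A.dom} (h : A.IsEigenfamily μ a v) (j : Fin n) : A.form (v j) (v j) = a j := by
  rw [h.1, h.2, if_pos rfl, mul_one]

theorem IsEigenfamily.nonneg {μ : Measure S} [IsFiniteMeasure μ] {n : ℕ} {a : Fin n → ℝ}
    {v : Fin n → A.dom} (h : A.IsEigenfamily μ a v) (j : Fin n) : 0 ≤ a j := by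
  rw [← h.form_self j]
  exact A.nonneg _

theorem HasEigenfamily.mono {μ : Measure S} [IsFiniteMeasure μ] {Λ Λ' : ℝ} {n : ℕ}
    (h : A.HasEigenfamily μ Λ n) (hΛ : Λ ≤ Λ') : A.HasEigenfamily μ Λ' n := by
  obtain ⟨a, v, h1, h2⟩ := h
  exact ⟨a, v, h1, fun j => (h2 j).trans hΛ⟩

theorem HasEigenfamily.of_le {μ : Measure S} [IsFiniteMeasure μ] {Λ : ℝ} {m n : ℕ}
    (h : A.HasEigenfamily μ Λ n) (hm : m ≤ n) : A.HasEigenfamily μ Λ m := by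
  obtain ⟨a, v, h1, h2⟩ := h
  refine ⟨a ∘ Fin.castLE hm, v ∘ Fin.castLE hm, ⟨fun j φ => h1.1 _ φ, fun i j => ?_⟩,
    fun j => h2 _⟩
  simp [h1.2, (Fin.castLE_injective hm).eq_iff]

theorem IsEigenfamily.snoc {μ : Measure S} [IsFiniteMeasure μ] {n : ℕ} {a : Fin n → ℝ}
    {v : Fin n → A.dom} (h : A.IsEigenfamily μ a v) {a' : ℝ} {f : A.dom}
    (hf : ∀ φ : A.dom, A.form f φ = a' * massForm μ f φ) (hf1 : massForm μ f f = 1)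
    (hfv : ∀ j, massForm μ f (v j) = 0) :
    A.IsEigenfamily μ (Fin.snoc a a' : Fin (n + 1) → ℝ) (Fin.snoc v f : Fin (n + 1) → A.dom) := by
  refine ⟨fun j φ => ?_, fun i j => ?_⟩
  · refine Fin.lastCases ?_ (fun j => ?_) j
    · simpa using hf φ
    · simpa using h.1 j φ
  · refine Fin.lastCases ?_ (fun j => ?_) j <;> refine Fin.lastCases ?_ (fun i => ?_) i
    · simpa using hf1
    · rw [Fin.snoc_castSucc, Fin.snoc_last, massForm_comm, hfv,
        if_neg (Fin.castSucc_lt_last i).ne]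
    · rw [Fin.snoc_castSucc, Fin.snoc_last, hfv, if_neg (Fin.castSucc_lt_last j).ne']
    · simp [h.2]

variable (A)

/-- Minimisation of the Rayleigh quotient over a closed subspace. -/
theorem exists_minimizer (μ : Measure S) [IsFiniteMeasure μ] (W : Submodule ℝ A.dom)
    (hW : ∀ (f : ℕ → A.dom) (g : A.dom), (∀ n, f n ∈ W) →
      Tendsto (fun n => (f n : C(S, ℝ))) atTop (𝓝 g) → g ∈ W)
    {u : A.dom} (hu : u ∈ W) (hu0 : 0 < massForm μ u u) {Λ : ℝ}
    (huΛ : A.form u u ≤ Λ * massForm μ u u) :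
    ∃ f ∈ W, ∃ a ≤ Λ, massForm μ f f = 1 ∧ ∀ φ ∈ W, A.form f φ = a * massForm μ f φ := by
  set P : Set A.dom := {f | f ∈ W ∧ massForm μ f f = 1} with hP
  set R : Set ℝ := (fun ψ => A.form ψ ψ) '' P with hR
  have hbdd : BddBelow R := ⟨0, by rintro _ ⟨ψ, _, rfl⟩; exact A.nonneg ψ⟩
  have hscale : ∀ f ∈ W, 0 < massForm μ f f → A.form f f / massForm μ f f ∈ R := by
    intro f hf h0
    have hs : √(massForm μ f f) ≠ 0 := (Real.sqrt_pos.2 h0).ne'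
    refine ⟨(√(massForm μ f f))⁻¹ • f, ⟨W.smul_mem _ hf, ?_⟩, ?_⟩
    · simp only [Submodule.coe_smul, map_smul, LinearMap.smul_apply, smul_eq_mul]
      field_simp
      exact (Real.sq_sqrt h0.le).symm
    · simp only [map_smul, LinearMap.smul_apply, smul_eq_mul]
      rw [← mul_assoc, ← mul_inv, Real.mul_self_sqrt h0.le]
      ring
  have hne : R.Nonempty := ⟨_, hscale u hu hu0⟩
  set a := sInf R
  have ha0 : 0 ≤ a := Real.sInf_nonneg (by rintro _ ⟨ψ, _, rfl⟩; exact A.nonneg ψ)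
  have haΛ : a ≤ Λ := (csInf_le hbdd (hscale u hu hu0)).trans ((div_le_iff₀ hu0).2 huΛ)
  -- The homogeneous form of minimality also covers functions of zero mass norm, which cannot be
  -- normalised.
  have hmin : ∀ f ∈ W, a * massForm μ f f ≤ A.form f f := by
    intro f hf
    rcases (massForm_self_nonneg μ (f : C(S, ℝ))).eq_or_lt with h0 | h0
    · rw [← h0, mul_zero]
      exact A.nonneg f
    · exact (le_div_iff₀ h0).1 (csInf_le hbdd (hscale f hf h0))
  have hmass : 0 < μ.real univ := by
    by_contra hneg
    have h0 : μ.real univ = 0 := le_antisymm (not_lt.1 hneg) measureReal_nonneg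
    have := (le_abs_self _).trans (abs_massForm_le μ (u : C(S, ℝ)) u)
    rw [h0, mul_zero] at this
    linarith
  obtain ⟨r, -, hr, hrR⟩ := exists_seq_tendsto_sInf hne hbdd
  choose f₀ hfP₀ hfr₀ using hrR
  obtain ⟨M₀, hM₀⟩ := hr.bddAbove_range
  have hM₀' : ∀ n, A.form (f₀ n) (f₀ n) ≤ M₀ := fun n => by
    have := hM₀ ⟨n, rfl⟩
    rwa [← hfr₀] at this
  set M := max M₀ (√(2 * A.bound ^ 2 * M₀ + 2 * 1 / μ.real univ))
  obtain ⟨g, -, σ, hσ, hg⟩ := (A.compact M).tendsto_subseq (x := fun n => (f₀ n : C(S, ℝ)))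
    (fun n => subset_closure ⟨f₀ n, rfl, (hM₀' n).trans (le_max_left _ _), by
      refine (A.norm_le_of_mass μ hmass le_rfl (f₀ n)).trans
        (le_trans (Real.sqrt_le_sqrt ?_) (le_max_right _ _))
      rw [(hfP₀ n).2]
      have := hM₀' n
      gcongr⟩)
  set f : ℕ → A.dom := f₀ ∘ σ with hf
  have hfW : ∀ n, f n ∈ W := fun n => (hfP₀ _).1
  have hf1 : ∀ n, massForm μ (f n) (f n) = 1 := fun n => (hfP₀ _).2
  have hfa : Tendsto (fun n => A.form (f n) (f n)) atTop (𝓝 a) :=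
    (hr.comp hσ.tendsto_atTop).congr fun n => (hfr₀ _).symm
  have hg : Tendsto (fun n => (f n : C(S, ℝ))) atTop (𝓝 g) := hg
  -- The parallelogram law and `hmin` for `f m + f n` bound the energy of the difference by the two
  -- defects from `a` plus `a` times its mass norm squared, which is small by uniform convergence.
  have hcauchy : ∀ ε > 0, ∃ N, ∀ m ≥ N, ∀ n ≥ N, A.form (f m - f n) (f m - f n) < ε := by
    intro ε hε
    have h1 : Tendsto (fun p : ℕ × ℕ => 2 * (A.form (f p.1) (f p.1) - a) +
        2 * (A.form (f p.2) (f p.2) - a) + a * (‖(f p.1 : C(S, ℝ)) - f p.2‖ *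
        ‖(f p.1 : C(S, ℝ)) - f p.2‖ * μ.real univ)) (atTop ×ˢ atTop) (𝓝 0) := by
      have t1 : Tendsto Prod.fst ((atTop : Filter ℕ) ×ˢ (atTop : Filter ℕ)) atTop := tendsto_fst
      have t2 : Tendsto Prod.snd ((atTop : Filter ℕ) ×ˢ (atTop : Filter ℕ)) atTop := tendsto_snd
      have e1 := ((hfa.comp t1).sub_const a).const_mul 2
      have e2 := ((hfa.comp t2).sub_const a).const_mul 2
      have e3 := ((hg.comp t1).sub (hg.comp t2)).norm
      have e4 := (e1.add e2).add (((e3.mul e3).mul_const (μ.real univ)).const_mul a)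
      simpa using e4
    have h2 := h1.eventually_lt_const hε
    rw [prod_atTop_atTop_eq, eventually_atTop] at h2
    obtain ⟨⟨N₁, N₂⟩, hN⟩ := h2
    refine ⟨max N₁ N₂, fun m hm n hn => lt_of_le_of_lt ?_
      (hN (m, n) ⟨(le_max_left _ _).trans hm, (le_max_right _ _).trans hn⟩)⟩
    have h3 := A.form_sub_add_form_add (f m) (f n)
    have h4 := hmin (f m + f n) (W.add_mem (hfW m) (hfW n))
    have h5 := (le_abs_self _).trans
      (abs_massForm_le μ ((f m : C(S, ℝ)) - f n) ((f m : C(S, ℝ)) - f n))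
    have h6 : massForm μ ((f m + f n : A.dom) : C(S, ℝ)) (f m + f n : A.dom) =
        4 - massForm μ ((f m : C(S, ℝ)) - f n) ((f m : C(S, ℝ)) - f n) := by
      simp only [Submodule.coe_add, map_sub, map_add, LinearMap.sub_apply, LinearMap.add_apply,
        hf1]
      ring
    rw [h6] at h4
    have h7 := mul_le_mul_of_nonneg_left h5 ha0
    simp only
    linarith
  obtain ⟨h, rfl, hh⟩ := A.complete f g hg hcauchy
  have hhW : h ∈ W := hW f h hfW hg
  have hha : A.form h h = a := tendsto_nhds_unique (A.tendsto_form_self_of_tendsto hh) hfa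
  have hh1 : massForm μ h h = 1 := by
    refine tendsto_nhds_unique (tendsto_massForm_of_tendsto (μs := fun _ : ℕ => ⟨μ, inferInstance⟩)
      (μ := ⟨μ, inferInstance⟩) tendsto_const_nhds hg hg) ?_
    exact tendsto_const_nhds.congr fun n => (hf1 n).symm
  refine ⟨h, hhW, a, haΛ, hh1, fun φ hφ => ?_⟩
  -- The quadratic form energy minus `a` times mass is nonnegative on `W` and vanishes at `h`, so
  -- its first variation there is zero.
  refine sub_eq_zero.1 (eq_zero_of_forall_quadratic_nonneg
    (d := A.form φ φ - a * massForm μ φ φ) fun t => ?_)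
  have h1 := hmin (h + t • φ) (W.add_mem hhW (W.smul_mem t hφ))
  simp only [Submodule.coe_add, Submodule.coe_smul, map_add, map_smul, LinearMap.add_apply,
    LinearMap.smul_apply, smul_eq_mul, hha, hh1] at h1
  rw [A.symm φ h, massForm_comm μ (φ : C(S, ℝ)) h] at h1
  linarith

end Measure

end EnergySpace

/-! ### Variational counting and convergence of eigenfamilies -/

namespace EnergySpace

variable {S : Type*} [TopologicalSpace S] [CompactSpace S] (A : EnergySpace S)
  [MeasurableSpace S] [OpensMeasurableSpace S]

/-- The trial space has dimension `N > n`, so it meets the mass-orthogonal complement of the family.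
The minimiser of the Rayleigh quotient on that complement is the new eigenfunction. -/
theorem IsEigenfamily.exists_extension {A : EnergySpace S} {μ : Measure S} [IsFiniteMeasure μ]
    {n N : ℕ} {Λ : ℝ} {a : Fin n → ℝ} {v : Fin n → A.dom} (h : A.IsEigenfamily μ a v)
    (hn : n < N) (T : (Fin N → ℝ) →ₗ[ℝ] A.dom)
    (hT0 : ∀ c ≠ 0, 0 < massForm μ (T c : C(S, ℝ)) (T c))
    (hT : ∀ c, A.form (T c) (T c) ≤ Λ * massForm μ (T c : C(S, ℝ)) (T c)) :
    ∃ a' ≤ Λ, ∃ f : A.dom,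
      A.IsEigenfamily μ (Fin.snoc a a' : Fin (n + 1) → ℝ) (Fin.snoc v f : Fin (n + 1) → A.dom) := by
  let Φ : A.dom →ₗ[ℝ] (Fin n → ℝ) := LinearMap.pi fun j =>
    ((massForm μ).flip (v j : C(S, ℝ))).comp A.dom.subtype
  have hΦ : ∀ f j, Φ f j = massForm μ (f : C(S, ℝ)) (v j) := fun f j => rfl
  have hker : LinearMap.ker (Φ.comp T) ≠ ⊥ :=
    LinearMap.ker_ne_bot_of_finrank_lt (by simpa using hn)
  obtain ⟨c, hc, hc0⟩ := Submodule.exists_mem_ne_zero_of_ne_bot hker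
  obtain ⟨f, hf, a', ha', hf1, hfφ⟩ := A.exists_minimizer μ (LinearMap.ker Φ)
    (fun f g hf hg => by
      rw [LinearMap.mem_ker]
      funext j
      rw [hΦ]
      refine tendsto_nhds_unique (tendsto_massForm_of_tendsto
        (μs := fun _ : ℕ => ⟨μ, inferInstance⟩) (μ := ⟨μ, inferInstance⟩) tendsto_const_nhds hg
        (tendsto_const_nhds (x := (v j : C(S, ℝ))))) ?_
      refine tendsto_const_nhds.congr fun m => ?_
      have := congrFun (LinearMap.mem_ker.1 (hf m)) j
      exact this.symm)
    (u := T c) (by simpa using hc) (hT0 c hc0) (hT c)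
  have hfv : ∀ j, massForm μ (f : C(S, ℝ)) (v j) = 0 := fun j =>
    congrFun (LinearMap.mem_ker.1 hf) j
  refine ⟨a', ha', f, h.snoc (fun φ => ?_) hf1 hfv⟩
  -- The minimiser satisfies its equation only against the complement. Its pairings with each `v j`
  -- vanish in mass, hence also in energy by the equation for `v j`, so removing the projection `ψ`
  -- from `φ` changes nothing.
  set ψ : A.dom := ∑ j, massForm μ (φ : C(S, ℝ)) (v j) • v j with hψ
  have hψ1 : massForm μ (f : C(S, ℝ)) ψ = 0 := by
    simp [hψ, hfv]
  have hψ2 : A.form f ψ = 0 := by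
    simp only [hψ, map_sum, map_smul]
    refine Finset.sum_eq_zero fun j _ => ?_
    rw [A.symm, h.1, massForm_comm μ (v j : C(S, ℝ)) f, hfv, mul_zero, smul_zero]
  have hmem : φ - ψ ∈ LinearMap.ker Φ := by
    rw [LinearMap.mem_ker]
    funext j
    rw [hΦ]
    simp [hψ, h.2]
  have := hfφ _ hmem
  rw [map_sub, hψ2, sub_zero, Submodule.coe_sub, map_sub, hψ1, sub_zero] at this
  exact this

/-- The variational lower bound for the number of eigenvalues. -/
theorem hasEigenfamily_of_subspace {μ : Measure S} [IsFiniteMeasure μ] {N : ℕ} {Λ : ℝ}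
    (T : (Fin N → ℝ) →ₗ[ℝ] A.dom) (hT0 : ∀ c ≠ 0, 0 < massForm μ (T c : C(S, ℝ)) (T c))
    (hT : ∀ c, A.form (T c) (T c) ≤ Λ * massForm μ (T c : C(S, ℝ)) (T c)) :
    A.HasEigenfamily μ Λ N := by
  suffices h : ∀ n ≤ N, A.HasEigenfamily μ Λ n from h N le_rfl
  intro n
  induction n with
  | zero => exact fun _ => ⟨Fin.elim0, Fin.elim0, ⟨fun j => j.elim0, fun j => j.elim0⟩,
      fun j => j.elim0⟩
  | succ n ih =>
    intro hn
    obtain ⟨a, v, h, hle⟩ := ih (by omega)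
    obtain ⟨a', ha', f, hf⟩ := h.exists_extension (by omega) T hT0 hT
    refine ⟨_, _, hf, fun j => ?_⟩
    refine Fin.lastCases ?_ (fun j => ?_) j
    · simpa using ha'
    · simpa using hle j

/-- The span of the family serves as trial space for the nearby measures: energies are unchanged and
the Gram matrices tend to the identity. -/
theorem HasEigenfamily.eventually {A : EnergySpace S} {μs : ℕ → FiniteMeasure S}
    {μ : FiniteMeasure S} (hμ : Tendsto μs atTop (𝓝 μ)) {Λ Λ' : ℝ} {n : ℕ} (hΛ0 : 0 ≤ Λ)
    (hΛ : Λ < Λ') (h : A.HasEigenfamily (μ : Measure S) Λ n) :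
    ∀ᶠ m in atTop, A.HasEigenfamily (μs m : Measure S) Λ' n := by
  obtain ⟨a, v, hv, ha⟩ := h
  let T : (Fin n → ℝ) →ₗ[ℝ] A.dom := Fintype.linearCombination ℝ v
  have hT : ∀ c, T c = ∑ i, c i • v i := fun c => Fintype.linearCombination_apply ℝ v c
  have hform : ∀ c, A.form (T c) (T c) ≤ Λ * ∑ i, c i ^ 2 := by
    intro c
    have e : A.form (T c) (T c) = ∑ i, a i * c i ^ 2 := by
      simp only [hT, map_sum, LinearMap.sum_apply, map_smul, LinearMap.smul_apply, smul_eq_mul,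
        hv.1, hv.2]
      refine Finset.sum_congr rfl fun i _ => ?_
      simp
      ring
    rw [e, Finset.mul_sum]
    exact Finset.sum_le_sum fun i _ => mul_le_mul_of_nonneg_right (ha i) (sq_nonneg _)
  have hΛ'0 : 0 < Λ' := hΛ0.trans_lt hΛ
  -- With this choice `Λ' * (1 - δ)` is the midpoint of `Λ` and `Λ'`.
  set δ : ℝ := (Λ' - Λ) / (2 * Λ') with hδ
  have hδ0 : 0 < δ := div_pos (by linarith) (by linarith)
  have hδ1 : δ < 1 := by
    rw [hδ, div_lt_one (by linarith)]
    linarith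
  have hδΛ : Λ ≤ Λ' * (1 - δ) := by
    have : Λ' * δ = (Λ' - Λ) / 2 := by
      rw [hδ]
      field_simp
    linarith
  -- If the entries of the Gram matrix are off by at most `ε`, the quadratic form is off by at most
  -- `n * ε ≤ δ`; the denominator `n + 1` allows `n = 0`.
  set ε : ℝ := δ / (n + 1) with hε
  have hε0 : 0 < ε := by positivity
  have hnε : n * ε ≤ δ := by
    rw [hε, mul_div_assoc', div_le_iff₀ (by positivity)]
    nlinarith
  have hev : ∀ᶠ m in atTop, ∀ i j, |massForm (μs m : Measure S) (v i : C(S, ℝ)) (v j) -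
      (if i = j then 1 else 0)| < ε := by
    refine eventually_all.2 fun i => eventually_all.2 fun j => ?_
    have := tendsto_massForm_of_tendsto hμ (tendsto_const_nhds (x := (v i : C(S, ℝ))))
      (tendsto_const_nhds (x := (v j : C(S, ℝ))))
    rw [hv.2] at this
    exact (Metric.tendsto_nhds.1 this) ε hε0
  filter_upwards [hev] with m hm
  have hlow : ∀ c, (1 - δ) * ∑ i, c i ^ 2 ≤
      massForm (μs m : Measure S) (T c : C(S, ℝ)) (T c) := by
    intro c
    have e1 : massForm (μs m : Measure S) (T c : C(S, ℝ)) (T c) =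
        ∑ i, ∑ j, c i * c j * massForm (μs m : Measure S) (v i : C(S, ℝ)) (v j) := by
      simp only [hT, AddSubmonoidClass.coe_finsetSum, Submodule.coe_smul, map_sum,
        LinearMap.sum_apply, map_smul, LinearMap.smul_apply, smul_eq_mul, Finset.mul_sum]
      rw [Finset.sum_comm]
      refine Finset.sum_congr rfl fun i _ => Finset.sum_congr rfl fun j _ => ?_
      ring
    have e2 : ∑ i, c i ^ 2 = ∑ i, ∑ j, c i * c j * (if i = j then 1 else 0) := by
      refine Finset.sum_congr rfl fun i _ => ?_
      simp [sq]
    have e3 : ∀ i j, c i * c j * (if i = j then 1 else 0) -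
        c i * c j * massForm (μs m : Measure S) (v i : C(S, ℝ)) (v j) ≤
        (c i ^ 2 + c j ^ 2) / 2 * ε := by
      intro i j
      rw [← mul_sub]
      refine (le_abs_self _).trans ?_
      rw [abs_mul, abs_sub_comm]
      refine mul_le_mul ?_ (hm i j).le (abs_nonneg _) (by positivity)
      rw [abs_mul]
      nlinarith [sq_nonneg (|c i| - |c j|), sq_abs (c i), sq_abs (c j)]
    have e4 : ∑ i, c i ^ 2 - massForm (μs m : Measure S) (T c : C(S, ℝ)) (T c) ≤
        ∑ i, ∑ j, (c i ^ 2 + c j ^ 2) / 2 * ε := by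
      rw [e1, e2, ← Finset.sum_sub_distrib]
      refine Finset.sum_le_sum fun i _ => ?_
      rw [← Finset.sum_sub_distrib]
      exact Finset.sum_le_sum fun j _ => e3 i j
    have e5 : ∑ i, ∑ j, (c i ^ 2 + c j ^ 2) / 2 * ε = n * ε * ∑ i, c i ^ 2 := by
      simp only [← Finset.sum_mul, ← Finset.sum_div, Finset.sum_add_distrib, Finset.sum_const,
        Finset.card_univ, Fintype.card_fin, nsmul_eq_mul, ← Finset.mul_sum]
      ring
    have e6 : n * ε * ∑ i, c i ^ 2 ≤ δ * ∑ i, c i ^ 2 :=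
      mul_le_mul_of_nonneg_right hnε (Finset.sum_nonneg fun i _ => sq_nonneg _)
    linarith
  refine A.hasEigenfamily_of_subspace T (fun c hc => ?_) fun c => ?_
  · refine lt_of_lt_of_le ?_ (hlow c)
    obtain ⟨i, hi⟩ := Function.ne_iff.1 hc
    have : 0 < ∑ i, c i ^ 2 := Finset.sum_pos' (fun i _ => sq_nonneg _)
      ⟨i, Finset.mem_univ i, by have : c i ≠ 0 := hi; positivity⟩
    exact mul_pos (by linarith) this
  · have h0 : 0 ≤ ∑ i, c i ^ 2 := Finset.sum_nonneg fun i _ => sq_nonneg _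
    calc A.form (T c) (T c) ≤ Λ * ∑ i, c i ^ 2 := hform c
      _ ≤ Λ' * (1 - δ) * ∑ i, c i ^ 2 := mul_le_mul_of_nonneg_right hδΛ h0
      _ = Λ' * ((1 - δ) * ∑ i, c i ^ 2) := by ring
      _ ≤ _ := mul_le_mul_of_nonneg_left (hlow c) hΛ'0.le

/-- Eigenfamilies with bounded eigenvalues subconverge to an eigenfamily of the limit measure. -/
theorem exists_subseq_tendsto_eigenfamily {μs : ℕ → FiniteMeasure S}
    {μ : FiniteMeasure S} (hμ : Tendsto μs atTop (𝓝 μ)) (hμ0 : μ ≠ 0) {Λ : ℝ} {n : ℕ}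
    {a : ℕ → Fin n → ℝ} {v : ℕ → Fin n → A.dom}
    (hv : ∀ m, A.IsEigenfamily (μs m : Measure S) (a m) (v m)) (ha : ∀ m j, a m j ≤ Λ) :
    ∃ σ : ℕ → ℕ, StrictMono σ ∧ ∃ (a' : Fin n → ℝ) (w : Fin n → A.dom),
      A.IsEigenfamily (μ : Measure S) a' w ∧
      (∀ j, Tendsto (fun i => a (σ i) j) atTop (𝓝 (a' j))) ∧
      ∀ j, Tendsto (fun i => (v (σ i) j : C(S, ℝ))) atTop (𝓝 (w j)) := by
  have hmass : Tendsto (fun m => (μs m : Measure S).real univ) atTop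
      (𝓝 ((μ : Measure S).real univ)) :=
    (NNReal.continuous_coe.tendsto _).comp hμ.mass
  have hpos : 0 < (μ : Measure S).real univ := by
    have : 0 < μ.mass := pos_iff_ne_zero.2 ((FiniteMeasure.mass_nonzero_iff μ).2 hμ0)
    exact_mod_cast this
  set m₀ : ℝ := (μ : Measure S).real univ
  -- From `N` on the masses lie between `m₀ / 2` and `2 * m₀`; the lower bound gives the sup bound,
  -- the upper one controls the mass form.
  obtain ⟨N, hN⟩ := eventually_atTop.1 ((hmass.eventually_const_lt (half_lt_self hpos)).and
    (hmass.eventually_lt_const (lt_two_mul_self hpos)))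
  set M := max Λ (√(2 * A.bound ^ 2 * Λ + 2 * 1 / (m₀ / 2)))
  have hnorm : ∀ m ≥ N, ∀ j, ‖(v m j : C(S, ℝ))‖ ≤ M := by
    intro m hm j
    refine (A.norm_le_of_mass _ (half_pos hpos) (hN m hm).1.le (v m j)).trans
      (le_trans (Real.sqrt_le_sqrt ?_) (le_max_right _ _))
    rw [(hv m).2, if_pos rfl, (hv m).form_self]
    have := ha m j
    gcongr
  have hK : IsCompact ((univ.pi fun _ : Fin n => Icc 0 Λ) ×ˢ (univ.pi fun _ : Fin n =>
      closure {g : C(S, ℝ) | ∃ f : A.dom, (f : C(S, ℝ)) = g ∧ A.form f f ≤ M ∧ ‖g‖ ≤ M})) :=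
    (isCompact_univ_pi fun _ => isCompact_Icc).prod (isCompact_univ_pi fun _ => A.compact M)
  obtain ⟨⟨a', w₀⟩, -, τ, hτ, hlim⟩ := hK.tendsto_subseq
    (x := fun i => (a (N + i), fun j => (v (N + i) j : C(S, ℝ)))) (fun i => by
      refine ⟨fun j _ => ⟨(hv _).nonneg j, ha _ j⟩, fun j _ => subset_closure ⟨_, rfl, ?_, ?_⟩⟩
      · rw [(hv _).form_self]
        exact (ha _ j).trans (le_max_left _ _)
      · exact hnorm _ (Nat.le_add_right _ _) j)
  rw [nhds_prod_eq] at hlim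
  set σ : ℕ → ℕ := fun i => N + τ i with hσ
  have hσmono : StrictMono σ := fun i j hij => Nat.add_lt_add_left (hτ hij) N
  have hσN : ∀ i, N ≤ σ i := fun i => Nat.le_add_right _ _
  have hla : ∀ j, Tendsto (fun i => a (σ i) j) atTop (𝓝 (a' j)) := fun j =>
    (tendsto_pi_nhds.1 (tendsto_fst.comp hlim)) j
  have hlv : ∀ j, Tendsto (fun i => (v (σ i) j : C(S, ℝ))) atTop (𝓝 (w₀ j)) := fun j =>
    (tendsto_pi_nhds.1 (tendsto_snd.comp hlim)) j
  have hμσ : Tendsto (fun i => μs (σ i)) atTop (𝓝 μ) := hμ.comp hσmono.tendsto_atTop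
  have hM0 : ∀ _ : Fin n, 0 ≤ M := fun j => (norm_nonneg _).trans (hnorm N le_rfl j)
  -- An index is required: for `n = 0` nothing forces `Λ ≥ 0`.
  have hΛ0 : ∀ _ : Fin n, 0 ≤ Λ := fun j => ((hv 0).nonneg j).trans (ha 0 j)
  -- By the eigenvalue equation, pairing with an eigenfunction in energy is bounded by the sup norm
  -- of the other argument. Uniform convergence therefore implies convergence in energy.
  have hbd : ∀ j i (d : A.dom), |A.form (v (σ i) j) d| ≤ Λ * (M * ‖(d : C(S, ℝ))‖ * (2 * m₀)) := by
    intro j i d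
    rw [(hv _).1, abs_mul, abs_of_nonneg ((hv _).nonneg j)]
    refine mul_le_mul (ha _ j) ?_ (abs_nonneg _) (hΛ0 j)
    refine (abs_massForm_le _ _ _).trans ?_
    have h1 := hnorm _ (hσN i) j
    have h2 := (hN _ (hσN i)).2.le
    have h3 := hM0 j
    gcongr
  have hcauchy : ∀ j, ∀ ε > 0, ∃ N', ∀ m ≥ N', ∀ k ≥ N',
      A.form (v (σ m) j - v (σ k) j) (v (σ m) j - v (σ k) j) < ε := by
    intro j ε hε
    have h1 : Tendsto (fun p : ℕ × ℕ => 2 * (Λ * (M * ‖(v (σ p.1) j : C(S, ℝ)) - v (σ p.2) j‖ *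
        (2 * m₀)))) (atTop ×ˢ atTop) (𝓝 0) := by
      have t1 : Tendsto Prod.fst ((atTop : Filter ℕ) ×ˢ (atTop : Filter ℕ)) atTop := tendsto_fst
      have t2 : Tendsto Prod.snd ((atTop : Filter ℕ) ×ˢ (atTop : Filter ℕ)) atTop := tendsto_snd
      have e3 := ((((hlv j).comp t1).sub ((hlv j).comp t2)).norm.const_mul M).mul_const (2 * m₀)
      simpa using (e3.const_mul Λ).const_mul 2
    have h2 := h1.eventually_lt_const hε
    rw [prod_atTop_atTop_eq, eventually_atTop] at h2
    obtain ⟨⟨N₁, N₂⟩, hN'⟩ := h2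
    refine ⟨max N₁ N₂, fun m hm k hk => lt_of_le_of_lt ?_
      (hN' (m, k) ⟨(le_max_left _ _).trans hm, (le_max_right _ _).trans hk⟩)⟩
    have b1 := (le_abs_self _).trans (hbd j m (v (σ m) j - v (σ k) j))
    have b2 := (neg_le_abs _).trans (hbd j k (v (σ m) j - v (σ k) j))
    rw [LinearMap.map_sub₂]
    rw [Submodule.coe_sub] at b1 b2
    simp only
    linarith
  choose w hw hwf using fun j => A.complete (fun i => v (σ i) j) (w₀ j) (hlv j) (hcauchy j)
  have hlv' : ∀ j, Tendsto (fun i => (v (σ i) j : C(S, ℝ))) atTop (𝓝 (w j)) := fun j =>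
    (hw j).symm ▸ hlv j
  refine ⟨σ, hσmono, a', w, ⟨fun j φ => ?_, fun i j => ?_⟩, hla, hlv'⟩
  · refine tendsto_nhds_unique (A.tendsto_form_of_tendsto (hwf j) φ) ?_
    refine ((hla j).mul (tendsto_massForm_of_tendsto hμσ (hlv' j)
      (tendsto_const_nhds (x := (φ : C(S, ℝ)))))).congr fun i => ?_
    exact ((hv _).1 j φ).symm
  · refine tendsto_nhds_unique (tendsto_massForm_of_tendsto hμσ (hlv' i) (hlv' j)) ?_
    exact tendsto_const_nhds.congr fun l => ((hv _).2 i j).symm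

/-- A Poincaré inequality: two orthonormal eigenfunctions span a nonzero `u` of mean zero, whose
squared mass norm is at most the squared oscillation times the total mass. Hence small mass forces a
large second eigenvalue. -/
theorem HasEigenfamily.one_le {A : EnergySpace S} {μ : Measure S} [IsFiniteMeasure μ] {Λ : ℝ}
    (h : A.HasEigenfamily μ Λ 2) : 1 ≤ A.bound ^ 2 * Λ * μ.real univ := by
  obtain ⟨a, v, hv, ha⟩ := h
  set s : ℝ := ∫ x, (v 0 : C(S, ℝ)) x ∂μ with hs
  set t : ℝ := ∫ x, (v 1 : C(S, ℝ)) x ∂μ with ht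
  obtain ⟨c, d, hcd, hst⟩ : ∃ c d : ℝ, 0 < c ^ 2 + d ^ 2 ∧ c * s + d * t = 0 := by
    by_cases h0 : s = 0 ∧ t = 0
    · exact ⟨1, 0, by norm_num, by rw [h0.1, h0.2]; ring⟩
    · refine ⟨t, -s, ?_, by ring⟩
      by_contra hneg
      refine h0 ⟨?_, ?_⟩ <;> nlinarith [sq_nonneg s, sq_nonneg t]
  set u : A.dom := c • v 0 + d • v 1 with hu
  have hmass : massForm μ (u : C(S, ℝ)) u = c ^ 2 + d ^ 2 := by
    simp only [hu, Submodule.coe_add, Submodule.coe_smul, map_add, map_smul, LinearMap.add_apply,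
      LinearMap.smul_apply, smul_eq_mul, hv.2]
    simp
    ring
  have hform : A.form u u ≤ Λ * (c ^ 2 + d ^ 2) := by
    have : A.form u u = c ^ 2 * a 0 + d ^ 2 * a 1 := by
      have e : ∀ i j, A.form (v i) (v j) = a i * if i = j then 1 else 0 := fun i j => by
        rw [hv.1, hv.2]
      simp only [hu, map_add, map_smul, LinearMap.add_apply, LinearMap.smul_apply, smul_eq_mul, e]
      simp
      ring
    rw [this]
    nlinarith [mul_le_mul_of_nonneg_left (ha 0) (sq_nonneg c),
      mul_le_mul_of_nonneg_left (ha 1) (sq_nonneg d)]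
  have hint : ∫ x, (u : C(S, ℝ)) x ∂μ = 0 := by
    have i0 := (v 0 : C(S, ℝ)).integrable_of_finite μ
    have i1 := (v 1 : C(S, ℝ)).integrable_of_finite μ
    have e : ∀ x, (u : C(S, ℝ)) x = c * (v 0 : C(S, ℝ)) x + d * (v 1 : C(S, ℝ)) x := fun x => rfl
    simp only [e]
    rw [integral_add (i0.const_mul c) (i1.const_mul d), integral_const_mul, integral_const_mul]
    exact hst
  have hne : Nonempty S := by
    by_contra hempty
    rw [not_nonempty_iff] at hempty
    have : massForm μ (u : C(S, ℝ)) u = 0 := by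
      rw [massForm_apply, Measure.eq_zero_of_isEmpty μ, integral_zero_measure]
    linarith
  obtain ⟨x₀⟩ := hne
  -- Any base point will do: since `u` has mean zero, integrating `(u - z)²` only adds the
  -- nonnegative term `z²` times the mass.
  set z := (u : C(S, ℝ)) x₀ with hz
  have h1 : ∀ x, (u : C(S, ℝ)) x * (u : C(S, ℝ)) x - 2 * z * (u : C(S, ℝ)) x + z ^ 2 ≤
      A.bound ^ 2 * A.form u u := by
    intro x
    have h2 := A.abs_sub_le u x x₀
    have h3 : ((u : C(S, ℝ)) x - z) ^ 2 ≤ A.bound ^ 2 * A.form u u := by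
      rw [← sq_abs, ← Real.sq_sqrt (A.nonneg u), ← mul_pow]
      exact pow_le_pow_left₀ (abs_nonneg _) h2 2
    linarith
  have j1 : Integrable (fun x => (u : C(S, ℝ)) x * (u : C(S, ℝ)) x) μ :=
    ((u : C(S, ℝ)) * (u : C(S, ℝ))).integrable_of_finite μ
  have j2 : Integrable (fun x => 2 * z * (u : C(S, ℝ)) x) μ :=
    ((u : C(S, ℝ)).integrable_of_finite μ).const_mul _
  have h4 := integral_mono (μ := μ) ((j1.sub j2).add (integrable_const (z ^ 2)))
    (integrable_const _) h1
  rw [integral_add' (j1.sub j2) (integrable_const _), integral_sub' j1 j2, integral_const_mul,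
    hint, integral_const, integral_const] at h4
  rw [massForm_apply] at hmass
  rw [hmass, smul_eq_mul, smul_eq_mul] at h4
  have hm : 0 ≤ μ.real univ := measureReal_nonneg
  have h5 : A.bound ^ 2 * A.form u u ≤ A.bound ^ 2 * (Λ * (c ^ 2 + d ^ 2)) :=
    mul_le_mul_of_nonneg_left hform (sq_nonneg _)
  have h6 := mul_le_mul_of_nonneg_left h5 hm
  have h7 : 0 ≤ μ.real univ * z ^ 2 := by positivity
  have h8 : 1 * (c ^ 2 + d ^ 2) ≤ A.bound ^ 2 * Λ * μ.real univ * (c ^ 2 + d ^ 2) := by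
    linarith
  exact le_of_mul_le_mul_right h8 hcd

end EnergySpace

/-! ### The energy space of a metric graph -/

namespace MetricGraph

variable {V E : Type*} (G : MetricGraph V E)

theorem continuous_onEdge {f : G.Space → ℝ} (hf : Continuous f) (e : E) :
    Continuous (G.onEdge f e) :=
  hf.comp (G.continuous_edgePoint e)

theorem memLp_onEdge [Finite V] [Finite E] (f : C(G.Space, ℝ)) (e : E) :
    MemLp (G.onEdge f e) 2 (volume.restrict (Ioo 0 (G.len e))) :=
  MemLp.of_bound (G.continuous_onEdge f.continuous e).aestronglyMeasurable ‖f‖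
    (Eventually.of_forall fun _ => f.norm_coe_le_norm _)

/-- The Sobolev space `H¹(G)` as a space of continuous functions. -/
def sobolevSpace [Finite V] [Finite E] : Submodule ℝ C(G.Space, ℝ) where
  carrier := {f | ∀ e, MemSobolev (G.len e) (G.onEdge f e)}
  add_mem' {f g} hf hg e := ⟨G.memLp_onEdge (f + g) e, _,
    (hf e).isL2WeakDeriv.add (hg e).isL2WeakDeriv (hf e).1 (hg e).1⟩
  zero_mem' e := ⟨G.memLp_onEdge 0 e, _, isL2WeakDeriv_const _ 0⟩
  smul_mem' c f hf e := ⟨G.memLp_onEdge (c • f) e, _, (hf e).isL2WeakDeriv.const_smul c⟩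

section Finite

variable [Finite V] [Finite E]

theorem isL2WeakDeriv_onEdge (f : G.sobolevSpace) (e : E) :
    IsL2WeakDeriv (G.len e) (G.onEdge (f : C(G.Space, ℝ)) e)
      (weakDeriv (G.len e) (G.onEdge (f : C(G.Space, ℝ)) e)) :=
  (f.2 e).isL2WeakDeriv

/-- The weak derivative along an edge. -/
noncomputable def edgeDeriv (e : E) :
    G.sobolevSpace →ₗ[ℝ] Lp ℝ 2 (volume.restrict (Ioo 0 (G.len e))) where
  toFun f := (G.isL2WeakDeriv_onEdge f e).memLp.toLp _
  map_add' f g := by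
    rw [← MemLp.toLp_add, MemLp.toLp_eq_toLp_iff]
    exact (G.isL2WeakDeriv_onEdge (f + g) e).ae_eq ((G.isL2WeakDeriv_onEdge f e).add
      (G.isL2WeakDeriv_onEdge g e) (f.2 e).1 (g.2 e).1)
  map_smul' c f := by
    rw [RingHom.id_apply, ← MemLp.toLp_const_smul, MemLp.toLp_eq_toLp_iff]
    exact (G.isL2WeakDeriv_onEdge (c • f) e).ae_eq ((G.isL2WeakDeriv_onEdge f e).const_smul c)

theorem edgeDeriv_apply (f : G.sobolevSpace) (e : E) :
    G.edgeDeriv e f = (G.isL2WeakDeriv_onEdge f e).memLp.toLp _ := rfl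

theorem abs_onEdge_sub_le (f : G.sobolevSpace) (e : E) {s t : ℝ} (hs : s ∈ Icc 0 (G.len e))
    (ht : t ∈ Icc 0 (G.len e)) :
    |(f : C(G.Space, ℝ)) (G.edgePoint e s) - (f : C(G.Space, ℝ)) (G.edgePoint e t)| ≤
      √|t - s| * ‖G.edgeDeriv e f‖ :=
  (G.isL2WeakDeriv_onEdge f e).abs_sub_le_of_mem_Icc
    (G.continuous_onEdge (f : C(G.Space, ℝ)).continuous e) (G.len_pos e) hs ht

end Finite

variable [Finite V] [Fintype E]

/-- The energy form on the Sobolev space. -/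
noncomputable def energyForm : LinearMap.BilinForm ℝ G.sobolevSpace :=
  ∑ e, (innerₗ (Lp ℝ 2 (volume.restrict (Ioo 0 (G.len e))))).compl₁₂
    (G.edgeDeriv e) (G.edgeDeriv e)

theorem energyForm_apply (f g : G.sobolevSpace) :
    G.energyForm f g = ∑ e, inner ℝ (G.edgeDeriv e f) (G.edgeDeriv e g) := by
  simp [energyForm, LinearMap.sum_apply]

theorem energyForm_self (f : G.sobolevSpace) :
    G.energyForm f f = ∑ e, ‖G.edgeDeriv e f‖ ^ 2 := by
  simp [energyForm_apply]

theorem energy_eq_energyForm (f g : G.sobolevSpace) :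
    G.energy (f : C(G.Space, ℝ)) (g : C(G.Space, ℝ)) = G.energyForm f g := by
  rw [energyForm_apply, energy]
  refine Finset.sum_congr rfl fun e _ => ?_
  rw [edgeDeriv_apply, edgeDeriv_apply, L2_inner_toLp]

theorem norm_edgeDeriv_le (f : G.sobolevSpace) (e : E) :
    ‖G.edgeDeriv e f‖ ≤ √(G.energyForm f f) := by
  refine Real.le_sqrt_of_sq_le ?_
  rw [energyForm_self]
  exact Finset.single_le_sum (f := fun e => ‖G.edgeDeriv e f‖ ^ 2) (fun _ _ => sq_nonneg _)
    (Finset.mem_univ e)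

/-- Connectedness enters here: the Hölder bounds of the edges add up along a chain from `v` to `w`.
-/
theorem exists_abs_vertex_sub_le (v w : V) : ∃ C : ℝ, 0 ≤ C ∧ ∀ f : G.sobolevSpace,
    |(f : C(G.Space, ℝ)) (G.vertex v) - (f : C(G.Space, ℝ)) (G.vertex w)| ≤
      C * √(G.energyForm f f) := by
  induction G.connected v w with
  | rel a b h =>
    obtain ⟨e, rfl, rfl⟩ := h
    refine ⟨√|G.len e - 0|, Real.sqrt_nonneg _, fun f => ?_⟩
    have hl := (G.len_pos e).le
    rw [← edgePoint_zero, ← edgePoint_len]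
    exact (G.abs_onEdge_sub_le f e ⟨le_rfl, hl⟩ ⟨hl, le_rfl⟩).trans
      (mul_le_mul_of_nonneg_left (G.norm_edgeDeriv_le f e) (Real.sqrt_nonneg _))
  | refl a => exact ⟨0, le_rfl, fun f => by simp⟩
  | symm a b _ ih =>
    obtain ⟨C, hC, h⟩ := ih
    exact ⟨C, hC, fun f => by rw [abs_sub_comm]; exact h f⟩
  | trans a b c _ _ ih₁ ih₂ =>
    obtain ⟨C₁, hC₁, h₁⟩ := ih₁
    obtain ⟨C₂, hC₂, h₂⟩ := ih₂
    refine ⟨C₁ + C₂, add_nonneg hC₁ hC₂, fun f => ?_⟩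
    rw [add_mul]
    exact (abs_sub_le _ _ _).trans (add_le_add (h₁ f) (h₂ f))

theorem exists_abs_sub_le : ∃ C : ℝ, 0 ≤ C ∧ ∀ (f : G.sobolevSpace) (x y : G.Space),
    |(f : C(G.Space, ℝ)) x - (f : C(G.Space, ℝ)) y| ≤ C * √(G.energyForm f f) := by
  have := Fintype.ofFinite V
  obtain ⟨v₀⟩ := G.nonempty
  choose C hC0 hC using fun v => G.exists_abs_vertex_sub_le v v₀
  have hCs : 0 ≤ ∑ v, C v := Finset.sum_nonneg fun v _ => hC0 v
  have hLs : 0 ≤ ∑ e, √(G.len e) := Finset.sum_nonneg fun e _ => Real.sqrt_nonneg _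
  have hv : ∀ (f : G.sobolevSpace) v,
      |(f : C(G.Space, ℝ)) (G.vertex v) - (f : C(G.Space, ℝ)) (G.vertex v₀)| ≤
        (∑ v, C v) * √(G.energyForm f f) := fun f v =>
    (hC v f).trans (mul_le_mul_of_nonneg_right
      (Finset.single_le_sum (fun v _ => hC0 v) (Finset.mem_univ v)) (Real.sqrt_nonneg _))
  have hx : ∀ (f : G.sobolevSpace) x,
      |(f : C(G.Space, ℝ)) x - (f : C(G.Space, ℝ)) (G.vertex v₀)| ≤
        (∑ v, C v + ∑ e, √(G.len e)) * √(G.energyForm f f) := by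
    intro f x
    rw [add_mul]
    rcases G.exists_vertex_or_edgePoint x with ⟨v, rfl⟩ | ⟨e, t, ht, rfl⟩
    · have := mul_nonneg hLs (Real.sqrt_nonneg (G.energyForm f f))
      linarith [hv f v]
    · have h1 := G.abs_onEdge_sub_le f e (Ioo_subset_Icc_self ht) ⟨le_rfl, (G.len_pos e).le⟩
      rw [edgePoint_zero] at h1
      have h2 : √|0 - t| * ‖G.edgeDeriv e f‖ ≤ (∑ e, √(G.len e)) * √(G.energyForm f f) := by
        refine mul_le_mul ?_ (G.norm_edgeDeriv_le f e) (norm_nonneg _) hLs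
        rw [zero_sub, abs_neg, abs_of_pos ht.1]
        exact (Real.sqrt_le_sqrt ht.2.le).trans
          (Finset.single_le_sum (fun e _ => Real.sqrt_nonneg (G.len e)) (Finset.mem_univ e))
      have h3 := abs_sub_le ((f : C(G.Space, ℝ)) (G.edgePoint e t))
        ((f : C(G.Space, ℝ)) (G.vertex (G.src e))) ((f : C(G.Space, ℝ)) (G.vertex v₀))
      linarith [hv f (G.src e)]
  refine ⟨2 * (∑ v, C v + ∑ e, √(G.len e)), by positivity, fun f x y => ?_⟩
  have h1 := hx f x
  have h2 := hx f y
  rw [abs_sub_comm] at h2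
  have h3 := abs_sub_le ((f : C(G.Space, ℝ)) x) ((f : C(G.Space, ℝ)) (G.vertex v₀))
    ((f : C(G.Space, ℝ)) y)
  linarith

theorem tendsto_toLp_onEdge {f : ℕ → C(G.Space, ℝ)} {g : C(G.Space, ℝ)}
    (hf : Tendsto f atTop (𝓝 g)) (e : E) :
    Tendsto (fun n => (G.memLp_onEdge (f n) e).toLp (G.onEdge (f n) e)) atTop
      (𝓝 ((G.memLp_onEdge g e).toLp (G.onEdge g e))) := by
  rw [tendsto_iff_norm_sub_tendsto_zero]
  have h0 := ((tendsto_iff_norm_sub_tendsto_zero.1 hf).const_mul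
    ((volume.restrict (Ioo 0 (G.len e))).real univ ^ (2 : ℝ≥0∞).toReal⁻¹))
  rw [mul_zero] at h0
  refine squeeze_zero (fun _ => norm_nonneg _) (fun n => ?_) h0
  refine Lp.norm_le_of_ae_bound (norm_nonneg _) ?_
  rw [← MemLp.toLp_sub]
  filter_upwards [((G.memLp_onEdge (f n) e).sub (G.memLp_onEdge g e)).coeFn_toLp] with x hx
  rw [hx]
  exact (f n - g).norm_coe_le_norm (G.edgePoint e x)

/-- The edge derivatives are Cauchy in `L²`, and their limits are weak derivatives of the uniform
limit. -/
theorem exists_tendsto_energyForm (f : ℕ → G.sobolevSpace) (g : C(G.Space, ℝ))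
    (hf : Tendsto (fun n => (f n : C(G.Space, ℝ))) atTop (𝓝 g))
    (hc : ∀ ε > 0, ∃ N, ∀ m ≥ N, ∀ n ≥ N, G.energyForm (f m - f n) (f m - f n) < ε) :
    ∃ h : G.sobolevSpace, (h : C(G.Space, ℝ)) = g ∧
      Tendsto (fun n => G.energyForm (f n - h) (f n - h)) atTop (𝓝 0) := by
  have hcauchy : ∀ e, CauchySeq fun n => G.edgeDeriv e (f n) := by
    intro e
    refine Metric.cauchySeq_iff.2 fun ε hε => ?_
    obtain ⟨N, hN⟩ := hc (ε ^ 2) (by positivity)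
    refine ⟨N, fun m hm n hn => ?_⟩
    rw [dist_eq_norm, ← map_sub]
    refine (G.norm_edgeDeriv_le _ e).trans_lt ?_
    rw [Real.sqrt_lt' hε]
    exact hN m hm n hn
  choose D hD using fun e => cauchySeq_tendsto_of_complete (hcauchy e)
  have hweak : ∀ e, IsL2WeakDeriv (G.len e) (G.onEdge g e) (D e) := by
    intro e
    refine ⟨Lp.memLp _, ?_⟩
    refine (isWeakDeriv_of_tendsto (G.tendsto_toLp_onEdge hf e) (hD e) fun n => ?_).congr_ae
      (MemLp.coeFn_toLp _) EventuallyEq.rfl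
    exact (G.isL2WeakDeriv_onEdge (f n) e).2.congr_ae (MemLp.coeFn_toLp _).symm
      (G.isL2WeakDeriv_onEdge (f n) e).memLp.coeFn_toLp.symm
  let h : G.sobolevSpace := ⟨g, fun e => ⟨G.memLp_onEdge g e, _, hweak e⟩⟩
  have hh : ∀ e, G.edgeDeriv e h = D e := by
    intro e
    rw [edgeDeriv_apply, ← Lp.toLp_coeFn (D e) (Lp.memLp _), MemLp.toLp_eq_toLp_iff]
    exact (G.isL2WeakDeriv_onEdge h e).ae_eq (hweak e)
  refine ⟨h, rfl, ?_⟩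
  have hsum : ∀ n, G.energyForm (f n - h) (f n - h) = ∑ e, ‖G.edgeDeriv e (f n) - D e‖ ^ 2 := by
    intro n
    rw [energyForm_self]
    exact Finset.sum_congr rfl fun e _ => by rw [map_sub, hh]
  simp only [hsum]
  have hlim := tendsto_finsetSum Finset.univ fun e _ =>
    (tendsto_iff_norm_sub_tendsto_zero.1 (hD e)).pow 2
  simpa using hlim

/-- Arzelà–Ascoli: an energy bound `M` gives the common modulus `√d * √M` on every edge. -/
theorem isCompact_closure_energyForm_le (M : ℝ) :
    IsCompact (closure {g : C(G.Space, ℝ) | ∃ f : G.sobolevSpace, (f : C(G.Space, ℝ)) = g ∧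
      G.energyForm f f ≤ M ∧ ‖g‖ ≤ M}) := by
  set K := {g : C(G.Space, ℝ) | ∃ f : G.sobolevSpace, (f : C(G.Space, ℝ)) = g ∧
    G.energyForm f f ≤ M ∧ ‖g‖ ≤ M} with hK
  have heq : Equicontinuous (fun (g : K) => ((g : C(G.Space, ℝ)) : G.Space → ℝ)) := by
    refine G.equicontinuous_of_forall_edge fun e => ?_
    refine Metric.equicontinuous_of_continuity_modulus (fun d => √d * √M) ?_ _ ?_
    · have : Continuous (fun d => √d * √M) := by fun_prop
      simpa using this.tendsto 0
    · rintro s t ⟨g, f, rfl, hf, -⟩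
      rw [Real.dist_eq, dist_comm, Subtype.dist_eq, Real.dist_eq]
      refine (G.abs_onEdge_sub_le f e s.2 t.2).trans
        (mul_le_mul_of_nonneg_left ?_ (Real.sqrt_nonneg _))
      exact (G.norm_edgeDeriv_le f e).trans (Real.sqrt_le_sqrt hf)
  let Φ := ContinuousMap.isometryEquivBoundedOfCompact G.Space ℝ
  have h1 : IsCompact (closure (Φ '' K)) := by
    refine BoundedContinuousFunction.arzela_ascoli (Icc (-M) M) isCompact_Icc _ ?_ ?_
    · rintro _ x ⟨g, ⟨f, rfl, -, hg⟩, rfl⟩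
      exact abs_le.1 (((f : C(G.Space, ℝ)).norm_coe_le_norm x).trans hg)
    · intro x U hU
      filter_upwards [heq x U hU] with y hy
      rintro ⟨_, g, hg, rfl⟩
      exact hy ⟨g, hg⟩
  have h2 : closure (Φ '' K) = Φ '' closure K := (Φ.toHomeomorph.image_closure K).symm
  rw [h2] at h1
  exact Φ.toHomeomorph.isCompact_image.1 h1

/-- The energy space of a metric graph. -/
noncomputable abbrev energySpace : EnergySpace G.Space where
  dom := G.sobolevSpace
  form := G.energyForm
  symm f g := by simp only [energyForm_apply, real_inner_comm]
  nonneg f := by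
    rw [energyForm_self]
    positivity
  bound := G.exists_abs_sub_le.choose
  bound_nonneg := G.exists_abs_sub_le.choose_spec.1
  abs_sub_le := G.exists_abs_sub_le.choose_spec.2
  complete := G.exists_tendsto_energyForm
  compact := G.isCompact_closure_energyForm_le

end MetricGraph

/-! ### Eigenvalues of the Laplacian as eigenfamilies -/

namespace MetricGraph

variable {V E : Type*} [Finite V] [Fintype E] (G : MetricGraph V E)

theorem mem_H1_iff {f : G.Space → ℝ} :
    f ∈ G.H1 ↔ ∃ F : G.energySpace.dom, ((F : C(G.Space, ℝ)) : G.Space → ℝ) = f := by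
  constructor
  · intro h
    exact ⟨⟨⟨f, h.1⟩, h.2⟩, rfl⟩
  · rintro ⟨F, rfl⟩
    exact ⟨(F : C(G.Space, ℝ)).continuous, F.2⟩

theorem coe_mem_H1 (F : G.energySpace.dom) : ((F : C(G.Space, ℝ)) : G.Space → ℝ) ∈ G.H1 :=
  G.mem_H1_iff.2 ⟨F, rfl⟩

theorem energy_coe (F F' : G.energySpace.dom) :
    G.energy (F : C(G.Space, ℝ)) (F' : C(G.Space, ℝ)) = G.energySpace.form F F' :=
  G.energy_eq_energyForm F F'

theorem isHarmonicOn_compl_iff (F : G.energySpace.dom) (K : Set G.Space) :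
    G.IsHarmonicOn (F : C(G.Space, ℝ)) Kᶜ ↔ ∀ g : G.energySpace.dom,
      (∀ x ∈ K, (g : C(G.Space, ℝ)) x = 0) → G.energySpace.form F g = 0 := by
  constructor
  · intro h g hg
    rw [← energy_coe]
    exact h _ (G.coe_mem_H1 g) fun x hx => hg x (notMem_compl_iff.1 hx)
  · intro h g hg hgK
    obtain ⟨g, rfl⟩ := G.mem_H1_iff.1 hg
    rw [energy_coe]
    exact h g fun x hx => hgK x (notMem_compl_iff.2 hx)

variable (μ : Measure G.Space) [IsFiniteMeasure μ]

theorem massForm_self_eq_zero_iff (f : C(G.Space, ℝ)) : massForm μ f f = 0 ↔ ⇑f =ᵐ[μ] 0 := by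
  rw [massForm_apply, integral_eq_zero_iff_of_nonneg (fun x => mul_self_nonneg (f x))
    ((f * f).integrable_of_finite μ)]
  refine ⟨fun h => ?_, fun h => ?_⟩
  · filter_upwards [h] with x hx
    exact mul_self_eq_zero.1 hx
  · filter_upwards [h] with x hx
    simp [hx]

theorem massForm_congr_support (f : C(G.Space, ℝ)) {g g' : C(G.Space, ℝ)}
    (h : ∀ x ∈ μ.support, g x = g' x) : massForm μ f g = massForm μ f g' := by
  rw [massForm_apply, massForm_apply]
  refine integral_congr_ae ?_
  filter_upwards [Measure.support_mem_ae (μ := μ)] with x hx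
  rw [h x hx]

/-- A general `φ` may be replaced by the harmonic extension of its values on the support: the mass
form sees only the support, and the energy against the harmonic `F` is unchanged. Conversely, the
full equation tested on functions vanishing on the support says that `F` is harmonic off it. -/
theorem isEigenfunction_iff (a : ℝ) (F : G.energySpace.dom) :
    G.IsEigenfunction μ a (F : C(G.Space, ℝ)) ↔ massForm μ (F : C(G.Space, ℝ)) F ≠ 0 ∧
      ∀ φ : G.energySpace.dom,
        G.energySpace.form F φ = a * massForm μ (F : C(G.Space, ℝ)) φ := by
  have hint : ∀ φ : C(G.Space, ℝ), ∫ x, a * (F : C(G.Space, ℝ)) x * φ x ∂μ =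
      a * massForm μ (F : C(G.Space, ℝ)) φ := by
    intro φ
    simp only [mul_assoc]
    rw [integral_const_mul, massForm_apply]
  rw [IsEigenfunction, ← massForm_self_eq_zero_iff]
  refine and_congr_right fun h0 => ⟨?_, fun h => ?_⟩
  · rintro ⟨⟨-, hharm⟩, -, heq⟩ φ
    have hμ : μ ≠ 0 := by
      rintro rfl
      exact h0 (by rw [massForm_self_eq_zero_iff, EventuallyEq, ae_zero]; trivial)
    obtain ⟨ψ, hψ, hψh⟩ := G.energySpace.exists_harmonic_extension
      (Measure.nonempty_support hμ) φ
    have h1 := heq _ ⟨G.coe_mem_H1 ψ, (G.isHarmonicOn_compl_iff ψ _).2 hψh⟩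
    rw [energy_coe, hint] at h1
    have h2 := (G.isHarmonicOn_compl_iff F _).1 hharm (φ - ψ) fun x hx => by
      rw [Submodule.coe_sub, ContinuousMap.sub_apply, hψ x hx, sub_self]
    rw [map_sub, sub_eq_zero] at h2
    rw [h2, h1, G.massForm_congr_support μ _ hψ]
  · refine ⟨⟨G.coe_mem_H1 F, (G.isHarmonicOn_compl_iff F _).2 fun g hg => ?_⟩, ?_, ?_⟩
    · rw [h, G.massForm_congr_support μ _ (g' := 0) hg, map_zero, mul_zero]
    · exact ((F : C(G.Space, ℝ)).memLp_two_of_finite μ).const_mul a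
    · rintro φ ⟨hφ, -⟩
      obtain ⟨φ, rfl⟩ := G.mem_H1_iff.1 hφ
      rw [energy_coe, h, hint]

/-- The inclusion of the Sobolev space into `L²(G, μ)`. -/
noncomputable def toL2 : G.energySpace.dom →ₗ[ℝ] Lp ℝ 2 μ where
  toFun f := ((f : C(G.Space, ℝ)).memLp_two_of_finite μ).toLp _
  map_add' _ _ := MemLp.toLp_add _ _
  map_smul' c _ := MemLp.toLp_const_smul c _

theorem coeFn_toL2 (f : G.energySpace.dom) : G.toL2 μ f =ᵐ[μ] (f : C(G.Space, ℝ)) :=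
  ((f : C(G.Space, ℝ)).memLp_two_of_finite μ).coeFn_toLp

theorem inner_toL2 (f g : G.energySpace.dom) :
    inner ℝ (G.toL2 μ f) (G.toL2 μ g) = massForm μ (f : C(G.Space, ℝ)) g := by
  rw [L2.inner_def, massForm_apply]
  refine integral_congr_ae ?_
  filter_upwards [G.coeFn_toL2 μ f, G.coeFn_toL2 μ g] with x h1 h2
  rw [h1, h2, real_inner_eq_re_inner, RCLike.inner_apply]
  simp [mul_comm]

variable {μ}

theorem natCast_le_rank_spectralSubspace {Λ : ℝ} {n : ℕ}
    (h : G.energySpace.HasEigenfamily μ Λ n) :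
    (n : Cardinal) ≤ Module.rank ℝ (G.spectralSubspace μ Λ) := by
  obtain ⟨a, v, hv, ha⟩ := h
  have hmem : ∀ j, G.toL2 μ (v j) ∈ G.spectralSubspace μ Λ := fun j =>
    Submodule.subset_span ⟨a j, ha j, _,
      (G.isEigenfunction_iff μ (a j) (v j)).2 ⟨by rw [hv.2]; simp, hv.1 j⟩, G.coeFn_toL2 μ _⟩
  have hon : Orthonormal ℝ fun j => G.toL2 μ (v j) := by
    rw [orthonormal_iff_ite]
    intro i j
    rw [inner_toL2, hv.2]
  have hli : LinearIndependent ℝ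
      fun j => (⟨G.toL2 μ (v j), hmem j⟩ : G.spectralSubspace μ Λ) :=
    LinearIndependent.of_comp (Submodule.subtype _) hon.linearIndependent
  have := hli.cardinal_lift_le_rank
  simpa using this

/-- By dimension some eigenfunction for an eigenvalue `≤ Λ` lies outside the span of the family; its
component orthogonal to the family, normalised, is the extension. -/
theorem exists_extension_of_le_rank {n N : ℕ} {Λ : ℝ} {a : Fin n → ℝ}
    {v : Fin n → G.energySpace.dom} (hv : G.energySpace.IsEigenfamily μ a v) (hn : n < N)
    (h : (N : Cardinal) ≤ Module.rank ℝ (G.spectralSubspace μ Λ)) :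
    ∃ a' ≤ Λ, ∃ f : G.energySpace.dom, G.energySpace.IsEigenfamily μ
      (Fin.snoc a a' : Fin (n + 1) → ℝ) (Fin.snoc v f : Fin (n + 1) → G.energySpace.dom) := by
  set W := Submodule.span ℝ (range fun j => G.toL2 μ (v j)) with hW
  have hrank : Module.rank ℝ W ≤ n := by
    have : Module.Finite ℝ W := FiniteDimensional.span_of_finite ℝ (finite_range _)
    rw [← Module.finrank_eq_rank]
    have := finrank_range_le_card (R := ℝ) fun j => G.toL2 μ (v j)
    rw [Fintype.card_fin] at this
    exact_mod_cast this
  have hnot : ¬ G.spectralSubspace μ Λ ≤ W := by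
    intro hle
    have := h.trans ((Submodule.rank_mono hle).trans hrank)
    exact absurd (Nat.cast_le.1 this) (not_le.2 hn)
  rw [spectralSubspace, Submodule.span_le, not_subset] at hnot
  obtain ⟨u, ⟨a', ha', f, hf, huf⟩, huW⟩ := hnot
  obtain ⟨F, rfl⟩ := G.mem_H1_iff.1 hf.2.1.1
  have hu : u = G.toL2 μ F := Lp.ext (huf.trans (G.coeFn_toL2 μ F).symm)
  have hF := ((G.isEigenfunction_iff μ a' F).1 hf).2
  set ψ : G.energySpace.dom := ∑ j, massForm μ (F : C(G.Space, ℝ)) (v j) • v j with hψ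
  -- Eigenfunctions for different eigenvalues are orthogonal, so `F` has components only along those
  -- `v j` with `a j = a'`, and the projection `ψ` solves the equation for `a'`.
  have hcoef : ∀ j, massForm μ (F : C(G.Space, ℝ)) (v j) * a j =
      massForm μ (F : C(G.Space, ℝ)) (v j) * a' := by
    intro j
    have h1 := hF (v j)
    rw [G.energySpace.symm, hv.1, massForm_comm μ (v j : C(G.Space, ℝ)) F] at h1
    linarith
  have hψeq : ∀ φ, G.energySpace.form ψ φ = a' * massForm μ (ψ : C(G.Space, ℝ)) φ := by
    intro φ
    simp only [hψ, AddSubmonoidClass.coe_finsetSum, Submodule.coe_smul, map_sum,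
      LinearMap.sum_apply, map_smul, LinearMap.smul_apply, smul_eq_mul, Finset.mul_sum]
    refine Finset.sum_congr rfl fun j _ => ?_
    rw [hv.1, ← mul_assoc, hcoef]
    ring
  set g : G.energySpace.dom := F - ψ with hg
  have hgeq : ∀ φ, G.energySpace.form g φ = a' * massForm μ (g : C(G.Space, ℝ)) φ := by
    intro φ
    rw [hg, Submodule.coe_sub, LinearMap.map_sub₂, LinearMap.map_sub₂, hF, hψeq, mul_sub]
  have hgv : ∀ j, massForm μ (g : C(G.Space, ℝ)) (v j) = 0 := by
    intro j
    simp [hg, hψ, hv.2]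
  have hg0 : massForm μ (g : C(G.Space, ℝ)) g ≠ 0 := by
    intro h0
    rw [← inner_toL2, inner_self_eq_zero, hg, map_sub, sub_eq_zero] at h0
    refine huW ?_
    rw [hu, h0, hψ, map_sum]
    refine Submodule.sum_mem _ fun j _ => ?_
    rw [map_smul]
    exact Submodule.smul_mem _ _ (Submodule.subset_span ⟨j, rfl⟩)
  have hgpos : 0 < massForm μ (g : C(G.Space, ℝ)) g :=
    (massForm_self_nonneg μ _).lt_of_ne' hg0
  refine ⟨a', ha', (√(massForm μ (g : C(G.Space, ℝ)) g))⁻¹ • g,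
    hv.snoc (fun φ => ?_) ?_ fun j => ?_⟩
  · rw [Submodule.coe_smul, LinearMap.map_smul₂, LinearMap.map_smul₂, hgeq, smul_eq_mul,
      smul_eq_mul]
    ring
  · rw [Submodule.coe_smul, LinearMap.map_smul₂, map_smul, smul_eq_mul, smul_eq_mul, ← mul_assoc,
      ← mul_inv, Real.mul_self_sqrt hgpos.le, inv_mul_cancel₀ hg0]
  · rw [Submodule.coe_smul, LinearMap.map_smul₂, hgv, smul_zero]

theorem hasEigenfamily_iff {Λ : ℝ} {N : ℕ} : G.energySpace.HasEigenfamily μ Λ N ↔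
    (N : Cardinal) ≤ Module.rank ℝ (G.spectralSubspace μ Λ) := by
  refine ⟨G.natCast_le_rank_spectralSubspace, fun h => ?_⟩
  suffices h : ∀ n ≤ N, G.energySpace.HasEigenfamily μ Λ n from h N le_rfl
  intro n
  induction n with
  | zero => exact fun _ => ⟨Fin.elim0, Fin.elim0, ⟨fun j => j.elim0, fun j => j.elim0⟩,
      fun j => j.elim0⟩
  | succ n ih =>
    intro hn
    obtain ⟨a, v, hv, hle⟩ := ih (by omega)
    obtain ⟨a', ha', f, hf⟩ := G.exists_extension_of_le_rank hv (by omega) h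
    refine ⟨_, _, hf, fun j => ?_⟩
    refine Fin.lastCases ?_ (fun j => ?_) j
    · simpa using ha'
    · simpa using hle j

theorem eigenvalue_le {Λ : ℝ≥0} {k : ℕ} (h : G.energySpace.HasEigenfamily μ Λ (k + 1)) :
    G.eigenvalue μ k ≤ Λ :=
  sInf_le ⟨Λ, rfl, G.hasEigenfamily_iff.1 h⟩

theorem hasEigenfamily_of_eigenvalue_lt {Λ : ℝ≥0} {k : ℕ} (h : G.eigenvalue μ k < Λ) :
    G.energySpace.HasEigenfamily μ Λ (k + 1) := by
  obtain ⟨_, ⟨Λ', rfl, hΛ'⟩, hlt⟩ := sInf_lt_iff.1 h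
  exact (G.hasEigenfamily_iff.2 hΛ').mono (by exact_mod_cast hlt.le)

theorem ne_zero_of_eigenvalue_lt_top {k : ℕ} (h : G.eigenvalue μ k < ⊤) : μ ≠ 0 := by
  rintro rfl
  obtain ⟨Λ, hΛ, -⟩ := ENNReal.lt_iff_exists_nnreal_btwn.1 h
  obtain ⟨a, v, hv, -⟩ := G.hasEigenfamily_of_eigenvalue_lt hΛ
  have := hv.2 0 0
  rw [massForm_apply, integral_zero_measure] at this
  simp at this

theorem isOrthonormalEigenfamily_iff {k : ℕ} {v : Fin (k + 1) → G.Space → ℝ} :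
    G.IsOrthonormalEigenfamily μ k v ↔ (∀ j : Fin (k + 1), G.eigenvalue μ j < ⊤) ∧
      ∃ w : Fin (k + 1) → G.energySpace.dom, (∀ j, ⇑(w j : C(G.Space, ℝ)) = v j) ∧
        G.energySpace.IsEigenfamily μ (fun j => (G.eigenvalue μ j).toReal) w := by
  constructor
  · rintro ⟨h1, h2⟩
    choose w hw using fun j => G.mem_H1_iff.1 (h1 j).2.2.1.1
    obtain rfl : (fun j => ⇑(w j : C(G.Space, ℝ))) = v := funext hw
    exact ⟨fun j => (h1 j).1, w, fun j => rfl,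
      fun j => ((G.isEigenfunction_iff μ _ (w j)).1 (h1 j).2).2, h2⟩
  · rintro ⟨h1, w, hw, h2⟩
    obtain rfl : (fun j => ⇑(w j : C(G.Space, ℝ))) = v := funext hw
    exact ⟨fun j => ⟨h1 j, (G.isEigenfunction_iff μ _ (w j)).2
      ⟨by rw [h2.2]; simp, h2.1 j⟩⟩, h2.2⟩

/-! ### Spectral continuity -/

section Limit

variable {μs : ℕ → FiniteMeasure G.Space} {μ : FiniteMeasure G.Space}

/-- Two intermediate levels are needed: one for an eigenfamily of the limit, the other for the loss
in `HasEigenfamily.eventually`. -/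
theorem eventually_eigenvalue_lt (hμ : Tendsto μs atTop (𝓝 μ)) {k : ℕ} {b : ℝ≥0∞}
    (hb : G.eigenvalue (μ : Measure G.Space) k < b) :
    ∀ᶠ m in atTop, G.eigenvalue (μs m : Measure G.Space) k < b := by
  obtain ⟨Λ', h1, h2⟩ := ENNReal.lt_iff_exists_nnreal_btwn.1 hb
  obtain ⟨Λ, h3, h4⟩ := ENNReal.lt_iff_exists_nnreal_btwn.1 h1
  filter_upwards [(G.hasEigenfamily_of_eigenvalue_lt h3).eventually hμ Λ.2
    (show (Λ : ℝ) < Λ' by exact_mod_cast h4)] with m hm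
  exact (G.eigenvalue_le hm).trans_lt h2

/-- Otherwise infinitely many `μs m` have `k + 1` eigenvalues below a level `Λ < λ_k(μ)`. By
compactness so does a limit `μ ≠ 0`; for `μ = 0` the Poincaré inequality excludes it, as `k + 1 ≥
2`. -/
theorem eventually_lt_eigenvalue (hμ : Tendsto μs atTop (𝓝 μ)) {k : ℕ} (h0 : μ ≠ 0 ∨ k ≠ 0)
    {b : ℝ≥0∞} (hb : b < G.eigenvalue (μ : Measure G.Space) k) :
    ∀ᶠ m in atTop, b < G.eigenvalue (μs m : Measure G.Space) k := by
  obtain ⟨Λ, h1, h2⟩ := ENNReal.lt_iff_exists_nnreal_btwn.1 hb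
  by_contra hneg
  have hfreq : ∃ᶠ m in atTop, G.energySpace.HasEigenfamily (μs m : Measure G.Space) Λ (k + 1) :=
    (not_eventually.1 hneg).mono fun m hm =>
      G.hasEigenfamily_of_eigenvalue_lt ((not_lt.1 hm).trans_lt h1)
  by_cases hμ0 : μ = 0
  · have hk : 2 ≤ k + 1 := by have := h0.resolve_left (not_not.2 hμ0); omega
    have hmass : Tendsto (fun m => (μs m : Measure G.Space).real univ) atTop (𝓝 0) := by
      have := (NNReal.continuous_coe.tendsto _).comp hμ.mass
      rw [hμ0, FiniteMeasure.zero_mass] at this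
      exact this
    have h3 := hmass.const_mul (G.energySpace.bound ^ 2 * Λ)
    rw [mul_zero] at h3
    obtain ⟨m, hm1, hm2⟩ := (hfreq.and_eventually (h3.eventually_lt_const one_pos)).exists
    exact absurd (hm1.of_le hk).one_le (not_le.2 hm2)
  · obtain ⟨τ, hτ, hfam⟩ := extraction_of_frequently_atTop hfreq
    choose a v hv ha using hfam
    obtain ⟨σ, -, a', w, hw, hlim, -⟩ := G.energySpace.exists_subseq_tendsto_eigenfamily
      (hμ.comp hτ.tendsto_atTop) hμ0 hv ha
    refine absurd (G.eigenvalue_le ⟨a', w, hw, fun j => ?_⟩) (not_le.2 h2)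
    exact le_of_tendsto' (hlim j) fun i => ha _ j

theorem tendsto_eigenvalue (hμ : Tendsto μs atTop (𝓝 μ)) {k : ℕ} (h0 : μ ≠ 0 ∨ k ≠ 0) :
    Tendsto (fun m => G.eigenvalue (μs m : Measure G.Space) k) atTop
      (𝓝 (G.eigenvalue (μ : Measure G.Space) k)) :=
  tendsto_order.2 ⟨fun _ hb => G.eventually_lt_eigenvalue hμ h0 hb,
    fun _ hb => G.eventually_eigenvalue_lt hμ hb⟩

theorem exists_subseq_tendstoUniformly_eigenfamily (hμ : Tendsto μs atTop (𝓝 μ)) {k : ℕ}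
    (hk : G.eigenvalue (μ : Measure G.Space) k < ⊤) {v : ℕ → Fin (k + 1) → G.Space → ℝ}
    (hv : ∀ᶠ m in atTop, G.IsOrthonormalEigenfamily (μs m : Measure G.Space) k (v m)) :
    ∃ n : ℕ → ℕ, StrictMono n ∧ ∃ w : Fin (k + 1) → G.Space → ℝ,
      (∀ j, TendstoUniformly (fun i => v (n i) j) (w j) atTop) ∧
      G.IsOrthonormalEigenfamily (μ : Measure G.Space) k w := by
  have hμ0 : μ ≠ 0 := by
    rintro rfl
    exact G.ne_zero_of_eigenvalue_lt_top hk FiniteMeasure.toMeasure_zero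
  obtain ⟨Λ', h3, h4⟩ := ENNReal.lt_iff_exists_nnreal_btwn.1 hk
  obtain ⟨Λ, h1, h2⟩ := ENNReal.lt_iff_exists_nnreal_btwn.1 h3
  have hΛ := G.hasEigenfamily_of_eigenvalue_lt h1
  have hjk : ∀ j : Fin (k + 1), (j : ℕ) + 1 ≤ k + 1 := fun j => by omega
  obtain ⟨N, hN⟩ := eventually_atTop.1 (hv.and (hΛ.eventually hμ Λ.2
    (show (Λ : ℝ) < Λ' by exact_mod_cast h2)))
  choose hfin f hfv hf using fun i =>
    G.isOrthonormalEigenfamily_iff.1 (hN (N + i) (Nat.le_add_right _ _)).1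
  have hshift : StrictMono fun i => N + i := fun i j hij => Nat.add_lt_add_left hij N
  have hμN : Tendsto (fun i => μs (N + i)) atTop (𝓝 μ) := hμ.comp hshift.tendsto_atTop
  obtain ⟨σ, hσ, a', w, hw, hla, hlw⟩ := G.energySpace.exists_subseq_tendsto_eigenfamily
    hμN hμ0 hf (Λ := Λ') (fun i j => by
      have := G.eigenvalue_le ((hN (N + i) (Nat.le_add_right _ _)).2.of_le (hjk j))
      exact ENNReal.toReal_mono ENNReal.coe_ne_top this)
  have hlt : ∀ j : Fin (k + 1), G.eigenvalue (μ : Measure G.Space) j < ⊤ := fun j =>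
    (G.eigenvalue_le (hΛ.of_le (hjk j))).trans_lt ENNReal.coe_lt_top
  have ha' : a' = fun j : Fin (k + 1) => (G.eigenvalue (μ : Measure G.Space) j).toReal := by
    funext j
    -- The limits supplied by compactness are identified through the convergence of eigenvalues
    -- already established.
    refine tendsto_nhds_unique (hla j) ?_
    exact ((ENNReal.tendsto_toReal (hlt j).ne).comp
      (G.tendsto_eigenvalue hμN (Or.inl hμ0))).comp hσ.tendsto_atTop
  refine ⟨fun i => N + σ i, hshift.comp hσ, fun j => ⇑(w j : C(G.Space, ℝ)), fun j => ?_,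
    G.isOrthonormalEigenfamily_iff.2 ⟨hlt, w, fun j => rfl, ha' ▸ hw⟩⟩
  have h5 := ContinuousMap.tendsto_iff_tendstoUniformly.1 (hlw j)
  simp only [hfv] at h5
  exact h5

end Limit

/-- A minimising sequence has a weak-* limit point among the probability measures. Being nonzero, it
falls under spectral continuity even for `k = 0`. -/
theorem exists_eigenvalue_eq_minEigenvalue (k : ℕ) :
    ∃ ν : ProbabilityMeasure G.Space,
      G.eigenvalue (ν : Measure G.Space) k = G.minEigenvalue k := by
  have hne : (range fun ν : ProbabilityMeasure G.Space =>
      G.eigenvalue (ν : Measure G.Space) k).Nonempty :=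
    ⟨_, ⟨Measure.dirac (Classical.arbitrary G.Space), inferInstance⟩, rfl⟩
  obtain ⟨r, -, hr, hrR⟩ := exists_seq_tendsto_sInf hne (OrderBot.bddBelow _)
  choose ν hν using hrR
  obtain ⟨ν', -, σ, hσ, hlim⟩ :=
    (isCompact_univ (X := ProbabilityMeasure G.Space)).tendsto_subseq (x := ν)
      fun _ => mem_univ _
  have hlim' : Tendsto (fun i => (ν (σ i)).toFiniteMeasure) atTop (𝓝 ν'.toFiniteMeasure) :=
    (ProbabilityMeasure.tendsto_nhds_iff_toFiniteMeasure_tendsto_nhds _).1 hlim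
  refine ⟨ν', tendsto_nhds_unique
    (G.tendsto_eigenvalue hlim' (k := k) (Or.inl ν'.toFiniteMeasure_nonzero)) ?_⟩
  exact (hr.comp hσ.tendsto_atTop).congr fun i => (hν (σ i)).symm

end MetricGraph

theorem mainTheorem3 {V E : Type*} [Finite V] [Fintype E] (G : MetricGraph V E) (k : ℕ) :
    (∀ (μs : ℕ → FiniteMeasure G.Space) (μ : FiniteMeasure G.Space),
      Tendsto μs atTop (𝓝 μ) →
        ((μ ≠ 0 ∨ k ≠ 0) →
          Tendsto (fun m => G.eigenvalue (μs m : Measure G.Space) k) atTop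
            (𝓝 (G.eigenvalue (μ : Measure G.Space) k))) ∧
        (G.eigenvalue (μ : Measure G.Space) k < ⊤ →
          (∀ᶠ m in atTop, G.eigenvalue (μs m : Measure G.Space) k < ⊤) ∧
          ∀ v : ℕ → Fin (k + 1) → G.Space → ℝ,
            (∀ᶠ m in atTop, G.IsOrthonormalEigenfamily (μs m : Measure G.Space) k (v m)) →
            ∃ n : ℕ → ℕ, StrictMono n ∧ ∃ w : Fin (k + 1) → G.Space → ℝ,
              (∀ j, TendstoUniformly (fun i => v (n i) j) (w j) atTop) ∧
              G.IsOrthonormalEigenfamily (μ : Measure G.Space) k w)) ∧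
    IsLeast (range fun ν : ProbabilityMeasure G.Space => G.eigenvalue (ν : Measure G.Space) k)
      (G.minEigenvalue k) := by
  refine ⟨fun μs μ hμ => ⟨fun h0 => G.tendsto_eigenvalue hμ h0, fun hk =>
    ⟨G.eventually_eigenvalue_lt hμ hk, fun v hv =>
      G.exists_subseq_tendstoUniformly_eigenfamily hμ hk hv⟩⟩,
    G.exists_eigenvalue_eq_minEigenvalue k, ?_⟩
  rintro _ ⟨ν, rfl⟩
  exact iInf_le _ ν
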